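/- **Theorem 2 (semi-ellipse type bound).** Let $\Omega\subset\mathbb R^2$ be the cross-section (in the coordinates $(y,z)$) of a flow along $x$, whose boundary consists of periodic, impermeable and/or free-surface parts. Let $\overline u,\overline B,\overline\rho,\overline q$ be real functions on $\Omega$ (streamwise velocity, streamwise magnetic field, density, total pressure), $C^1$, bounded with bounded first derivatives and periodic in the periodic directions; let $G$ be a $C^2$ potential with bounded gradient, and let $\gamma,\mu_0>0$ be constants. Assume that $\overline\rho$ and $\overline p=\overline q-\overline B^2/(2\mu_0)$ are bounded below by positive constants and that $\nabla\overline q=\overline\rho\,\nabla G$. Put $$s=\sqrt{\gamma\overline p/\overline\rho},\qquad a=\overline B/\sqrt{\mu_0\overline\rho},\qquad N_1^2=\frac{G_y\overline\rho_y}{\overline\rho}-\frac{G_y^2}{s^2},\quad N_2^2=\frac{G_z\overline\rho_z}{\overline\rho}-\frac{G_z^2}{s^2},\quad N_{12}^2=\frac{G_z\overline\rho_y}{\overline\rho}-\frac{G_yG_z}{s^2},$$ $$\overline u_\pm=\tfrac12\bigl(\max_\Omega\overline u\pm\min_\Omega\overline u\bigr),\qquad a_M^2=\max_\Omega a^2,\qquad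 J=\frac{N_1^2+N_2^2}{\overline u_y^2+\overline u_z^2},\qquad J_m=\min_\Omega J,$$ where the minimum $J_m$ is over the points with $\nabla\overline u\ne0$, and minima and maxima are understood as infima and suprema, and $$\lambda_M=\max_\Omega\tfrac12\Bigl(\sqrt{T^2+4J_m\bigl(\overline u_z^2N_1^2+\overline u_y^2N_2^2-2\overline u_y\overline u_zN_{12}^2\bigr)}-T\Bigr),\qquad T=N_1^2+N_2^2-J_m(\overline u_y^2+\overline u_z^2).$$ Let $k>0$ and let $c=c_r+ic_i$ with $c_i\neq0$ be the complex phase speed of an unstable mode, that is, with $U=\overline u-c$ there are complex amplitudes $(\tilde v^x,\tilde v^y,\tilde v^z,\tilde b^x,\tilde b^y,\tilde b^z,\tilde\rho,\tilde q)$ on $\Omega$, not all identically zero, periodic in the periodic directions, with $\tilde v^y,\tilde v^z,\tilde b^y,\tilde b^z,\tilde q$ of class $C^1$, solving the linearised ideal compressible magnetohydrodynamic equations $$\begin{aligned} &\overline\rho\{ikU\tilde v^x+\tilde v^y\overline u_y+\tilde v^z\overline u_z\}-\tfrac1{\mu_0}\{ik\overline B\tilde b^x+\tilde b^y\overline B_y+\tilde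 b^z\overline B_z\}+ik\tilde q=0,\\ &\overline\rho\, ikU\tilde v^y-\tfrac1{\mu_0}ik\overline B\tilde b^y+\tilde q_y-G_y\tilde\rho=0,\qquad \overline\rho\, ikU\tilde v^z-\tfrac1{\mu_0}ik\overline B\tilde b^z+\tilde q_z-G_z\tilde\rho=0,\\ &ikU\tilde b^x+\tilde v^y\overline B_y+\tilde v^z\overline B_z-\{ik\overline B\tilde v^x+\tilde b^y\overline u_y+\tilde b^z\overline u_z\}+\overline B(ik\tilde v^x+\tilde v^y_y+\tilde v^z_z)=0,\\ &ikU\tilde b^y-ik\overline B\tilde v^y=0,\qquad ikU\tilde b^z-ik\overline B\tilde v^z=0,\qquad ik\tilde b^x+\tilde b^y_y+\tilde b^z_z=0,\\ &ikU\tilde\rho+\tilde v^y\overline\rho_y+\tilde v^z\overline\rho_z+\overline\rho(ik\tilde v^x+\tilde v^y_y+\tilde v^z_z)=0,\\ &ikU\bigl(s^2\tilde\rho+\tfrac{\overline B\tilde b^x}{\mu_0}-\tilde q\bigr)+\tilde v^y\bigl(s^2\overline\rho_y+\tfrac{\overline B\,\overline B_y}{\mu_0}-G_y\overline\rho\bigr)+\tilde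 v^z\bigl(s^2\overline\rho_z+\tfrac{\overline B\,\overline B_z}{\mu_0}-G_z\overline\rho\bigr)=0, \end{aligned}$$ such that the displacement $(\eta,\zeta)=(\tilde v^y,\tilde v^z)/(ikU)$ and its divergence $\eta_y+\zeta_z$ are square integrable over $\Omega$ (one period), the normal component of $(\eta,\zeta)$ vanishes (in the weak sense) on the impermeable boundary, and $\tilde q=0$ on the free surface, if there is one. Assume $N_1^2+N_2^2\ge0$ everywhere in $\Omega$. Put $\mu=1-\lambda_M/(k^2c_i^2)$. Then $$(c_r-\overline u_+)^2+\Gamma c_i^2\le\overline u_-^2-\min_\Omega\min\Bigl(a^2,\frac{c_i^4}{s^2}\Bigr),$$ where $$\Gamma=\max\Bigl(1,\ \mu+4\mu^2J_m\Bigl\{1+\sqrt{1+\mu\bigl(a_M^2/c_i^2-4J_m\bigr)}\Bigr\}^{-2}\Bigr)\ \text{ if }\mu>0,\qquad \Gamma=1\ \text{ otherwise};$$ for $\mu>0$ the argument of the square root is positive. If $J_m>\frac14$, then moreover $$c_i^2<\frac{(4J_mk^{-2}\lambda_M+a_M^2)+\sqrt{(4J_mk^{-2}\lambda_M+a_M^2)^2-4(4J_m-1)k^{-2}\lambda_Ma_M^2}}{2(4J_m-1)}.$$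 -/

import Mathlib

open MeasureTheory Set Filter Topology

noncomputable section

namespace MagnetoShear

/-- Partial derivative in the first transverse coordinate `y` of `(y, z)`. -/
def dy {E : Type*} [NormedAddCommGroup E] [NormedSpace ℝ E] (f : ℝ × ℝ → E) (x : ℝ × ℝ) : E :=
  fderiv ℝ f x (1, 0)

/-- Partial derivative in the second transverse coordinate `z` of `(y, z)`. -/
def dz {E : Type*} [NormedAddCommGroup E] [NormedSpace ℝ E] (f : ℝ × ℝ → E) (x : ℝ × ℝ) : E :=
  fderiv ℝ f x (0, 1)

/-- The transverse cross-section of the flow.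

`D` is the open set of the `(y, z)`-plane filled by fluid, continued periodically in the
periodic directions; `periods` is the discrete group of its periods (`⊥` if no part of the boundary
is periodic, rank one or two otherwise), and `cell` is one period of `D` (`D` itself if
`periods = ⊥`), the set over which one integrates. `free` is the part of the boundary of `D`
(possibly empty) that is a free surface; the rest of the boundary is impermeable. -/
structure CrossSection where
  D : Set (ℝ × ℝ)
  periods : AddSubgroup (ℝ × ℝ)
  cell : Set (ℝ × ℝ)
  free : Set (ℝ × ℝ)
  isOpen_D : IsOpen D
  discrete_periods : DiscreteTopology periods
  add_mem_D : ∀ l ∈ periods, ∀ x ∈ D, x + l ∈ D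
  cell_subset : cell ⊆ D
  isFundamentalDomain : IsAddFundamentalDomain periods cell (volume.restrict D)
  free_subset : free ⊆ frontier D

/-- Invariance of a field on `D` under the periods. -/
def CrossSection.IsPeriodic (R : CrossSection) {E : Type*} (f : ℝ × ℝ → E) : Prop :=
  ∀ l ∈ R.periods, ∀ x ∈ R.D, f (x + l) = f x

/-- `f` is continuously differentiable on `D`, and `f` and its first derivatives are bounded. -/
def CrossSection.IsBoundedC1 (R : CrossSection) (f : ℝ × ℝ → ℝ) : Prop :=
  ContDiffOn ℝ 1 f R.D ∧ ∃ C : ℝ, ∀ x ∈ R.D, |f x| ≤ C ∧ |dy f x| ≤ C ∧ |dz f x| ≤ C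

/-- The data of a base state: streamwise velocity `u`, streamwise magnetic field `B`, density `ρ`,
total pressure `q`, potential `G` of the body force, adiabatic exponent `γ` and vacuum
permeability `μ₀`. -/
structure BaseState where
  u : ℝ × ℝ → ℝ
  B : ℝ × ℝ → ℝ
  ρ : ℝ × ℝ → ℝ
  q : ℝ × ℝ → ℝ
  G : ℝ × ℝ → ℝ
  γ : ℝ
  μ₀ : ℝ

namespace BaseState

variable (S : BaseState)

/-- Kinematic pressure. -/
def p (x : ℝ × ℝ) : ℝ := S.q x - S.B x ^ 2 / (2 * S.μ₀)

/-- Local sound speed. -/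
def s (x : ℝ × ℝ) : ℝ := Real.sqrt (S.γ * S.p x / S.ρ x)

/-- Local Alfvén speed. -/
def a (x : ℝ × ℝ) : ℝ := S.B x / Real.sqrt (S.μ₀ * S.ρ x)

/-- The buoyancy frequency `N₁²`. -/
def N1sq (x : ℝ × ℝ) : ℝ := dy S.G x * dy S.ρ x / S.ρ x - dy S.G x ^ 2 / S.s x ^ 2

/-- The buoyancy frequency `N₂²`. -/
def N2sq (x : ℝ × ℝ) : ℝ := dz S.G x * dz S.ρ x / S.ρ x - dz S.G x ^ 2 / S.s x ^ 2

/-- The buoyancy frequency `N₁₂²`. -/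
def N12sq (x : ℝ × ℝ) : ℝ := dz S.G x * dy S.ρ x / S.ρ x - dy S.G x * dz S.G x / S.s x ^ 2

/-- The squared shear `u_y² + u_z²`. -/
def shearSq (x : ℝ × ℝ) : ℝ := dy S.u x ^ 2 + dz S.u x ^ 2

/-- The net Richardson number `J`, meaningful where the shear does not vanish. -/
def J (x : ℝ × ℝ) : ℝ := (S.N1sq x + S.N2sq x) / S.shearSq x

/-- An admissible base state on the cross-section `R`: a magneto-static equilibrium with positive
density and pressure (uniformly, as for continuous positive functions up to the boundary). -/
structure IsAdmissible (R : CrossSection) : Prop where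
  γ_pos : 0 < S.γ
  μ₀_pos : 0 < S.μ₀
  u_reg : R.IsBoundedC1 S.u
  B_reg : R.IsBoundedC1 S.B
  ρ_reg : R.IsBoundedC1 S.ρ
  q_reg : R.IsBoundedC1 S.q
  G_reg : ContDiffOn ℝ 2 S.G R.D
  G_bdd : ∃ C : ℝ, ∀ x ∈ R.D, |dy S.G x| ≤ C ∧ |dz S.G x| ≤ C
  ρ_pos : ∃ ε > 0, ∀ x ∈ R.D, ε ≤ S.ρ x
  p_pos : ∃ ε > 0, ∀ x ∈ R.D, ε ≤ S.p x
  u_periodic : R.IsPeriodic S.u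
  B_periodic : R.IsPeriodic S.B
  ρ_periodic : R.IsPeriodic S.ρ
  q_periodic : R.IsPeriodic S.q
  magnetostatic_y : ∀ x ∈ R.D, dy S.q x - S.ρ x * dy S.G x = 0
  magnetostatic_z : ∀ x ∈ R.D, dz S.q x - S.ρ x * dz S.G x = 0

/-- `u₊`, half the sum of the maximum and the minimum of the base velocity. -/
def uPlus (R : CrossSection) : ℝ := (sSup (S.u '' R.D) + sInf (S.u '' R.D)) / 2

/-- `u₋`, half the difference of the maximum and the minimum of the base velocity. -/
def uMinus (R : CrossSection) : ℝ := (sSup (S.u '' R.D) - sInf (S.u '' R.D)) / 2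

/-- `a_M²`, the maximum of the squared Alfvén speed. -/
def aMsq (R : CrossSection) : ℝ := sSup ((fun x => S.a x ^ 2) '' R.D)

/-- `J_m`, the minimum of the net Richardson number, taken over the points where it is defined. -/
def Jm (R : CrossSection) : ℝ := sInf (S.J '' {x ∈ R.D | S.shearSq x ≠ 0})

/-- The quantity whose maximum is `λ_M`:
`½ (√((u_y² + u_z²)² (J - J_m)² + 4 u_y² u_z² J_m (J₁ + J₂ - 2 J₁₂)) - (u_y² + u_z²) (J - J_m))`,
where `J₁ = N₁² / u_y²`, `J₂ = N₂² / u_z²`, `J₁₂ = N₁₂² / (u_y u_z)`. All products are multiplied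
out, so that the expression makes sense also where `u_y` or `u_z` vanishes:
`(u_y² + u_z²) (J - J_m) = N₁² + N₂² - J_m (u_y² + u_z²)` and
`u_y² u_z² (J₁ + J₂ - 2 J₁₂) = u_z² N₁² + u_y² N₂² - 2 u_y u_z N₁₂²`. -/
def misalignment (R : CrossSection) (x : ℝ × ℝ) : ℝ :=
  (Real.sqrt ((S.N1sq x + S.N2sq x - S.Jm R * S.shearSq x) ^ 2
      + 4 * S.Jm R * (dz S.u x ^ 2 * S.N1sq x + dy S.u x ^ 2 * S.N2sq x
          - 2 * dy S.u x * dz S.u x * S.N12sq x))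
    - (S.N1sq x + S.N2sq x - S.Jm R * S.shearSq x)) / 2

/-- `λ_M`. -/
def lamM (R : CrossSection) : ℝ := sSup (S.misalignment R '' R.D)

/-- `min_Ω min (a², c_i⁴ / s²)`. -/
def Θ (R : CrossSection) (c : ℂ) : ℝ :=
  sInf ((fun x => min (S.a x ^ 2) (c.im ^ 4 / S.s x ^ 2)) '' R.D)

/-- `μ = 1 - λ_M / (k² c_i²)`. -/
def μ (R : CrossSection) (k : ℝ) (c : ℂ) : ℝ := 1 - S.lamM R / (k ^ 2 * c.im ^ 2)

/-- The argument `1 + μ (a_M² / c_i² - 4 J_m)` of the square root in `Γ`. -/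
def radicand (R : CrossSection) (k : ℝ) (c : ℂ) : ℝ :=
  1 + S.μ R k c * (S.aMsq R / c.im ^ 2 - 4 * S.Jm R)

open Classical in
/-- The coefficient `Γ` of `c_i²`. -/
def Gam (R : CrossSection) (k : ℝ) (c : ℂ) : ℝ :=
  if 0 < S.μ R k c then
    max 1 (S.μ R k c + 4 * S.μ R k c ^ 2 * S.Jm R
      * ((1 + Real.sqrt (S.radicand R k c)) ^ 2)⁻¹)
  else 1

/-- The upper bound of `c_i²` for `J_m > 1/4`. -/
def ciSqBound (R : CrossSection) (k : ℝ) : ℝ :=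
  ((4 * S.Jm R * (S.lamM R / k ^ 2) + S.aMsq R)
    + Real.sqrt ((4 * S.Jm R * (S.lamM R / k ^ 2) + S.aMsq R) ^ 2
        - 4 * (4 * S.Jm R - 1) * (S.lamM R / k ^ 2) * S.aMsq R))
  / (2 * (4 * S.Jm R - 1))

end BaseState

/-- Amplitudes of a normal mode perturbation `(…) e^{ik(x - ct)}`: velocity, magnetic field,
density and total pressure. -/
structure Perturbation where
  vx : ℝ × ℝ → ℂ
  vy : ℝ × ℝ → ℂ
  vz : ℝ × ℝ → ℂ
  bx : ℝ × ℝ → ℂ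
  bY : ℝ × ℝ → ℂ
  bz : ℝ × ℝ → ℂ
  ρ : ℝ × ℝ → ℂ
  q : ℝ × ℝ → ℂ

/-- The shifted base velocity `U = u - c`. -/
def shifted (S : BaseState) (c : ℂ) (x : ℝ × ℝ) : ℂ := (S.u x : ℂ) - c

/-- The linearised ideal compressible magnetohydrodynamic equations at the point `x`. -/
structure Perturbation.SolvesLinearisedAt (w : Perturbation) (S : BaseState) (k : ℝ) (c : ℂ)
    (x : ℝ × ℝ) : Prop where
  momentum_x :
    S.ρ x * (shifted S c x * (Complex.I * k) * w.vx x
        + (w.vy x * dy S.u x + w.vz x * dz S.u x))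
      - 1 / S.μ₀ * (S.B x * (Complex.I * k) * w.bx x + (w.bY x * dy S.B x + w.bz x * dz S.B x))
      + Complex.I * k * w.q x = 0
  momentum_y :
    S.ρ x * (shifted S c x * (Complex.I * k) * w.vy x)
      - 1 / S.μ₀ * (S.B x * (Complex.I * k) * w.bY x)
      + (dy w.q x - dy S.G x * w.ρ x) = 0
  momentum_z :
    S.ρ x * (shifted S c x * (Complex.I * k) * w.vz x)
      - 1 / S.μ₀ * (S.B x * (Complex.I * k) * w.bz x)
      + (dz w.q x - dz S.G x * w.ρ x) = 0
  induction_x :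
    (shifted S c x * (Complex.I * k) * w.bx x + (w.vy x * dy S.B x + w.vz x * dz S.B x))
      - (S.B x * (Complex.I * k) * w.vx x + (w.bY x * dy S.u x + w.bz x * dz S.u x))
      + S.B x * (Complex.I * k * w.vx x + dy w.vy x + dz w.vz x) = 0
  induction_y :
    shifted S c x * (Complex.I * k) * w.bY x - S.B x * (Complex.I * k) * w.vy x = 0
  induction_z :
    shifted S c x * (Complex.I * k) * w.bz x - S.B x * (Complex.I * k) * w.vz x = 0
  gauss : Complex.I * k * w.bx x + dy w.bY x + dz w.bz x = 0
  mass :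
    shifted S c x * (Complex.I * k) * w.ρ x + (w.vy x * dy S.ρ x + w.vz x * dz S.ρ x)
      + S.ρ x * (Complex.I * k * w.vx x + dy w.vy x + dz w.vz x) = 0
  energy :
    shifted S c x * (Complex.I * k)
        * ((S.s x : ℂ) ^ 2 * w.ρ x + S.B x * w.bx x / S.μ₀ - w.q x)
      + w.vy x * ((S.s x : ℂ) ^ 2 * dy S.ρ x + S.B x * dy S.B x / S.μ₀ - dy S.G x * S.ρ x)
      + w.vz x * ((S.s x : ℂ) ^ 2 * dz S.ρ x + S.B x * dz S.B x / S.μ₀ - dz S.G x * S.ρ x) = 0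

/-- The component `η` of the Lagrangian displacement: `v^y = ik U η`. -/
def Perturbation.η (w : Perturbation) (S : BaseState) (k : ℝ) (c : ℂ) (x : ℝ × ℝ) : ℂ :=
  w.vy x / (Complex.I * k * shifted S c x)

/-- The component `ζ` of the Lagrangian displacement: `v^z = ik U ζ`. -/
def Perturbation.ζ (w : Perturbation) (S : BaseState) (k : ℝ) (c : ℂ) (x : ℝ × ℝ) : ℂ :=
  w.vz x / (Complex.I * k * shifted S c x)

/-- Periodic test functions of class `C¹ ∩ H¹` that vanish on the free surface. No condition is
imposed on the impermeable part of the boundary. -/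
structure CrossSection.IsTest (R : CrossSection) (χ : ℝ × ℝ → ℂ) : Prop where
  contDiffOn : ContDiffOn ℝ 1 χ R.D
  periodic : R.IsPeriodic χ
  memLp : MemLp χ 2 (volume.restrict R.cell)
  memLp_dy : MemLp (dy χ) 2 (volume.restrict R.cell)
  memLp_dz : MemLp (dz χ) 2 (volume.restrict R.cell)
  free : ∀ x ∈ R.free, Tendsto χ (𝓝[R.D] x) (𝓝 0)

/-- The normal component of the transverse vector field `(f, g)` vanishes on the impermeable part
of the boundary, in the weak sense: the normal trace of `(f, g)` annihilates every test function.
For fields that are `C¹` up to a piecewise smooth boundary this is the pointwise condition. -/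
def CrossSection.NormalComponentVanishes (R : CrossSection) (f g : ℝ × ℝ → ℂ) : Prop :=
  ∀ χ : ℝ × ℝ → ℂ, R.IsTest χ →
    ∫ x in R.cell, (χ x * (dy f x + dz g x) + (dy χ x * f x + dz χ x * g x)) = 0

/-- `w` is a normal mode with wavenumber `k` and complex phase speed `c`: a nontrivial, periodic
solution of the linearised equations on `D`, of finite energy, with vanishing normal displacement
on the impermeable boundary and vanishing total pressure on the free surface. -/
structure IsNormalMode (R : CrossSection) (S : BaseState) (k : ℝ) (c : ℂ) (w : Perturbation) :
    Prop where
  vy_reg : ContDiffOn ℝ 1 w.vy R.D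
  vz_reg : ContDiffOn ℝ 1 w.vz R.D
  bY_reg : ContDiffOn ℝ 1 w.bY R.D
  bz_reg : ContDiffOn ℝ 1 w.bz R.D
  q_reg : ContDiffOn ℝ 1 w.q R.D
  solves : ∀ x ∈ R.D, w.SolvesLinearisedAt S k c x
  periodic : R.IsPeriodic fun x =>
    (w.vx x, w.vy x, w.vz x, w.bx x, w.bY x, w.bz x, w.ρ x, w.q x)
  memLp_η : MemLp (w.η S k c) 2 (volume.restrict R.cell)
  memLp_ζ : MemLp (w.ζ S k c) 2 (volume.restrict R.cell)
  memLp_div : MemLp (fun x => dy (w.η S k c) x + dz (w.ζ S k c) x) 2 (volume.restrict R.cell)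
  impermeable : R.NormalComponentVanishes (w.η S k c) (w.ζ S k c)
  free_surface : ∀ x ∈ R.free, Tendsto w.q (𝓝[R.D] x) (𝓝 0)
  nontrivial : ∃ x ∈ R.D,
    (w.vx x, w.vy x, w.vz x, w.bx x, w.bY x, w.bz x, w.ρ x, w.q x) ≠ 0

end MagnetoShear

end

/-! Every amplitude is a linear expression in the displacement ξ = (η, ζ), its divergence δ and the
reduced compression P = (s²δ + ξ·∇G)/(s² - U²) (`IsNormalMode.amplitudes`, `IsNormalMode.grad_q`).
The coefficients are bounded because c is not real, so total pressure and its gradient are square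
integrable. Hence the conjugate of φ(u)q̃ is an admissible test function in the weak boundary
condition for every C¹ weight φ. This gives a family of integral identities (`weighted_identity`),
of which two are used.

With φ = 1 the identity is ∫ρ(U²A - K) = 0, where A = k²|ξ|² + |P|², and K collects magnetic,
acoustic and buoyancy energy. This rests on ∇ρ being parallel to ∇G, which makes the buoyancy form
symmetric and, since N₁² + N₂² ≥ 0, positive semidefinite. Howard's combination of real and
imaginary parts gives a semicircle inequality in which the buoyancy energy is kept (`semicircle`). A
lower bound of that energy by a multiple of c_i²∫ρA therefore improves the circle to an ellipse.

The bound comes from the weight φ = |U|/U (`phase_balance`). In the imaginary part A and K enter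
with the same sign, as |U|A + K/|U|, and are balanced only by cross terms with the shear h = ξ·∇u.
Young's inequality and absorption into a²|δ|² control these cross terms (`cross_terms_ge`), while
J_m|h|² is bounded by buoyancy plus λ_M|ξ|² (`le_buoyancy`), λ_M coming from a lowest eigenvalue.
What remains is a scalar quadratic inequality in the ratio of shear to wave energy. It forces the
radicand to be positive and bounds the ratio, and with it the buoyancy, from below
(`energy_dichotomy`). The weights are removed by |U| ≥ |c_i|. The bound on c_i² for J_m > 1/4 is the
positivity of the radicand, read as a quadratic inequality in c_i². -/

noncomputable section

namespace MagnetoShear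

open Complex ComplexConjugate

/-! ### Algebra: Hermitian forms, scalar quadratic inequalities, the pointwise energy identity. -/

/-- A Hermitian form with real symmetric positive semidefinite coefficient matrix is nonnegative. -/
lemma hermitian_form_nonneg {m₁ m₂ m₁₂ : ℝ} (h₁ : 0 ≤ m₁) (h₂ : 0 ≤ m₂) (hd : m₁₂ ^ 2 ≤ m₁ * m₂)
    (η ζ : ℂ) : 0 ≤ m₁ * normSq η + m₂ * normSq ζ + 2 * m₁₂ * (η * conj ζ).re := by
  -- With real coefficients the form splits into two copies of a real quadratic form, in the real
  -- and in the imaginary parts.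
  have key : ∀ a b : ℝ, 0 ≤ m₁ * a ^ 2 + m₂ * b ^ 2 + 2 * m₁₂ * (a * b) := by
    intro a b
    rcases h₁.eq_or_lt with h | h
    · have : m₁₂ = 0 := by
        rw [← h] at hd
        nlinarith
      rw [this, ← h]
      nlinarith [mul_nonneg h₂ (sq_nonneg b)]
    · have : 0 ≤ m₁ * (m₁ * a ^ 2 + m₂ * b ^ 2 + 2 * m₁₂ * (a * b)) := by
        nlinarith [sq_nonneg (m₁ * a + m₁₂ * b), mul_nonneg (sub_nonneg.2 hd) (sq_nonneg b)]
      exact nonneg_of_mul_nonneg_right this h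
  have := add_nonneg (key η.re ζ.re) (key η.im ζ.im)
  simp only [normSq_apply, mul_re, conj_re, conj_im]
  linarith

/-- The lowest eigenvalue of a symmetric `2 × 2` matrix bounds the associated Hermitian form. -/
lemma hermitian_form_ge {m₁ m₂ m₁₂ D : ℝ} (hD : D = (m₁ + m₂) ^ 2 - 4 * (m₁ * m₂ - m₁₂ ^ 2))
    (η ζ : ℂ) :
    -((Real.sqrt D - (m₁ + m₂)) / 2) * (normSq η + normSq ζ)
      ≤ m₁ * normSq η + m₂ * normSq ζ + 2 * m₁₂ * (η * conj ζ).re := by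
  have hD' : D = (m₁ - m₂) ^ 2 + 4 * m₁₂ ^ 2 := by rw [hD]; ring
  have hsq : Real.sqrt D ^ 2 = D := Real.sq_sqrt (by rw [hD']; positivity)
  have habs : |m₁ - m₂| ≤ Real.sqrt D :=
    Real.abs_le_sqrt (by rw [hD']; nlinarith [sq_nonneg m₁₂])
  obtain ⟨h1, h2⟩ := abs_le.1 habs
  -- Subtracting the lowest eigenvalue from the diagonal leaves a matrix of determinant zero with
  -- nonnegative diagonal.
  have := hermitian_form_nonneg (m₁ := m₁ + (Real.sqrt D - (m₁ + m₂)) / 2)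
    (m₂ := m₂ + (Real.sqrt D - (m₁ + m₂)) / 2) (m₁₂ := m₁₂) (by linarith) (by linarith)
    (by nlinarith) η ζ
  linarith

/-- The quadratic inequality that fixes the ellipticity coefficient. -/
lemma radicand_pos_and_le {μ J α y : ℝ} (hμ : 0 < μ) (hy : 0 < y)
    (h : μ + 4 * J * y ^ 2 < 2 * y + α * y ^ 2) :
    0 < 1 + μ * (α - 4 * J) ∧ μ / (1 + Real.sqrt (1 + μ * (α - 4 * J))) ≤ y := by
  have hrad : 0 < 1 + μ * (α - 4 * J) := by
    rcases le_or_gt (4 * J) α with hb | hb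
    · have := mul_nonneg hμ.le (sub_nonneg.2 hb)
      linarith
    -- With b = 4J - α > 0, the left side equals (by - 1)² - (1 - μb), so 1 - μb, the radicand, is
    -- positive.
    · have h2 : (4 * J - α) * (μ - 2 * y + (4 * J - α) * y ^ 2) < 0 :=
        mul_neg_of_pos_of_neg (by linarith) (by linarith)
      nlinarith [sq_nonneg ((4 * J - α) * y - 1)]
  refine ⟨hrad, ?_⟩
  set r := Real.sqrt (1 + μ * (α - 4 * J)) with hr
  have hr0 : 0 < r := Real.sqrt_pos.2 hrad
  have hr2 : r ^ 2 = 1 + μ * (α - 4 * J) := Real.sq_sqrt hrad.le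
  rw [div_le_iff₀ (by linarith)]
  by_contra! hlt
  have h1 : 0 < μ - y * (1 + r) := by linarith
  have h2 : 0 < μ - y * (1 - r) := by nlinarith
  have h3 := mul_pos h1 h2
  -- If y were too small, both factors μ - y(1 ± r) would be positive, yet their product is μ times
  -- a quantity that `h` makes negative.
  have h4 : (μ - y * (1 + r)) * (μ - y * (1 - r))
      = μ * (μ + 4 * J * y ^ 2 - (2 * y + α * y ^ 2)) := by
    linear_combination (-y ^ 2) * hr2
  rw [h4] at h3
  nlinarith [mul_pos hμ (sub_pos.2 h)]

/-- From the weighted energy balance to the lower bound of the buoyancy energy. `Ee`, `Ep`, `X`, `g`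
stand for the energies of displacement, pressure and buoyancy and for the shear term. -/
lemma energy_dichotomy {μ J α Ee Ep X g : ℝ} (hμ : 0 < μ) (hJ : 0 ≤ J) (hEe : 0 < Ee)
    (hEp : 0 ≤ Ep) (hg : 0 ≤ g) (hX : J * g ≤ X + (1 - μ) * (Ee + Ep))
    (h : ∀ t > 0, Ee + Ep + X ≤ (t * Ep + g / t) / 2 + α / 4 * g) :
    0 < 1 + μ * (α - 4 * J) ∧
      (μ + 4 * μ ^ 2 * J * ((1 + Real.sqrt (1 + μ * (α - 4 * J))) ^ 2)⁻¹ - 1) * (Ee + Ep) ≤ X := by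
  have hE : 0 < Ee + Ep := by linarith
  have hg' : 0 < g := by
    rcases hg.eq_or_lt with h0 | h0
    -- Without shear, t = μ would give μ(Ee + Ep) ≤ μEp/2, against Ee > 0.
    · have h1 := h μ hμ
      rw [← h0] at h1 hX
      simp only [mul_zero, zero_div, add_zero] at h1 hX
      nlinarith [mul_pos hμ hEe, mul_nonneg hμ.le hEp]
    · exact h0
  set E := Ee + Ep with hEdef
  -- The Young parameter will be t = √(g/E) = 2y. Using E instead of Ep keeps it meaningful when Ep
  -- = 0 and makes both halves of the Young term multiples of y.
  set y := Real.sqrt (g / E) / 2 with hy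
  have hy0 : 0 < y := half_pos (Real.sqrt_pos.2 (div_pos hg' hE))
  have hgy : g = 4 * y ^ 2 * E := by
    have : Real.sqrt (g / E) ^ 2 = g / E := Real.sq_sqrt (div_pos hg' hE).le
    rw [hy, div_pow, this]
    field_simp
    norm_num
  have h1 := h (2 * y) (by linarith)
  have h2 : g / (2 * y) = 2 * y * E := by rw [hgy]; field_simp; norm_num
  have h3 : μ + 4 * J * y ^ 2 < 2 * y + α * y ^ 2 := by
    have h4 : (μ + 4 * J * y ^ 2) * E < (2 * y + α * y ^ 2) * E := by
      rw [h2] at h1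
      -- The displacement energy lost in Ep < E supplies the strictness that later makes the
      -- radicand strictly positive.
      have : y * Ep < y * E := mul_lt_mul_of_pos_left (by linarith) hy0
      rw [hgy] at h1 hX
      nlinarith
    exact lt_of_mul_lt_mul_right h4 hE.le
  obtain ⟨hr, hle⟩ := radicand_pos_and_le hμ hy0 h3
  refine ⟨hr, ?_⟩
  set r := Real.sqrt (1 + μ * (α - 4 * J))
  have hr0 : 0 < 1 + r := by have := Real.sqrt_nonneg (1 + μ * (α - 4 * J)); positivity
  have h5 : 4 * μ ^ 2 * J * ((1 + r) ^ 2)⁻¹ ≤ 4 * J * y ^ 2 := by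
    have h6 : (μ / (1 + r)) ^ 2 ≤ y ^ 2 := pow_le_pow_left₀ (by positivity) hle 2
    calc 4 * μ ^ 2 * J * ((1 + r) ^ 2)⁻¹ = 4 * J * (μ / (1 + r)) ^ 2 := by
          rw [div_pow]; ring
      _ ≤ _ := by gcongr
  have h7 := mul_le_mul_of_nonneg_right h5 hE.le
  rw [hgy] at hX
  nlinarith

/-- A point where an upward quadratic is negative lies below its larger root. -/
lemma lt_larger_root {A b d X : ℝ} (hA : 0 < A) (h : A * X ^ 2 - b * X + d < 0) :
    X < (b + Real.sqrt (b ^ 2 - 4 * A * d)) / (2 * A) := by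
  rw [lt_div_iff₀ (by linarith)]
  have : 2 * A * X - b < Real.sqrt (b ^ 2 - 4 * A * d) := by
    apply Real.lt_sqrt_of_sq_lt
    nlinarith
  linarith

/-- The momentum balance tested with the conjugate displacement, at one point. -/
lemma energy_density_identity {ρ s2 a2 k gy gz ry rz n₁ n₂ n₁₂ : ℝ} {U η ζ δ P : ℂ}
    (hρ : ρ ≠ 0) (hs : s2 ≠ 0) (hpar : gz * ry = gy * rz)
    (hn₁ : n₁ = gy * ry / ρ - gy ^ 2 / s2) (hn₂ : n₂ = gz * rz / ρ - gz ^ 2 / s2)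
    (hn₁₂ : n₁₂ = gz * ry / ρ - gy * gz / s2)
    (hP : (s2 - U ^ 2) * P = s2 * δ + (gy * η + gz * ζ)) :
    ρ * (U ^ 2 * P - a2 * δ) * conj δ
      + ((k ^ 2 * ρ * (U ^ 2 - a2) * η + gy * (ρ * (P - δ) - (η * ry + ζ * rz))) * conj η
        + (k ^ 2 * ρ * (U ^ 2 - a2) * ζ + gz * (ρ * (P - δ) - (η * ry + ζ * rz))) * conj ζ)
    = ρ * (U ^ 2 * (k ^ 2 * (normSq η + normSq ζ) + normSq P : ℝ)
        - (k ^ 2 * a2 * (normSq η + normSq ζ) + normSq U ^ 2 / s2 * normSq P + a2 * normSq δ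
          + (n₁ * normSq η + n₂ * normSq ζ + 2 * n₁₂ * (η * conj ζ).re) : ℝ)) := by
  have hPc : (s2 - conj U ^ 2) * conj P = s2 * conj δ + (gy * conj η + gz * conj ζ) := by
    have := congrArg conj hP
    simpa using this
  have hre : (2 * (η * conj ζ).re : ℂ) = η * conj ζ + conj η * ζ := by
    have := Complex.add_conj (η * conj ζ)
    simp only [map_mul, conj_conj] at this
    rw [this]; push_cast; ring
  have hρ' : (ρ : ℂ) ≠ 0 := by exact_mod_cast hρ
  have hs' : (s2 : ℂ) ≠ 0 := by exact_mod_cast hs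
  have hpar' : (gz * ry : ℂ) = gy * rz := by exact_mod_cast hpar
  have e1 : conj δ = ((s2 - conj U ^ 2) * conj P - (gy * conj η + gz * conj ζ)) / s2 := by
    rw [hPc]; field_simp; ring
  have e2 : δ = ((s2 - U ^ 2) * P - (gy * η + gz * ζ)) / s2 := by
    rw [hP]; field_simp; ring
  -- Eliminating δ by the relation for P and by its conjugate removes the mixed products of P with
  -- ξ; |ξ·∇G|²/s² remains and becomes part of the buoyancy form.
  have e3 : (U ^ 2 * P) * conj δ + (gy * conj η + gz * conj ζ) * (P - δ)
      = U ^ 2 * (P * conj P) - (U * conj U) ^ 2 / s2 * (P * conj P)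
        + (gy * η + gz * ζ) * (gy * conj η + gz * conj ζ) / s2 := by
    rw [e1]; nth_rewrite 1 [e2]; field_simp; ring
  -- The two mixed products of η and ζ have equal coefficients only because ∇ρ and ∇G are parallel.
  have e4 : (gy * conj η + gz * conj ζ) * (η * ry + ζ * rz) -
      ρ * ((gy * η + gz * ζ) * (gy * conj η + gz * conj ζ) / s2)
      = ρ * (n₁ * (η * conj η) + n₂ * (ζ * conj ζ) + n₁₂ * (η * conj ζ + conj η * ζ)) := by
    rw [hn₁, hn₂, hn₁₂]; push_cast; field_simp
    linear_combination (-(s2 : ℂ) * conj η * ζ) * hpar'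
  push_cast
  have e5 : (2 * n₁₂ * (η * conj ζ).re : ℂ) = n₁₂ * (η * conj ζ + conj η * ζ) := by
    rw [← hre]; ring
  rw [e5]
  simp only [← Complex.mul_conj]
  linear_combination ρ * e3 - e4

/-! ### Calculus of the transverse derivatives. -/

lemma dy_mul {f g : ℝ × ℝ → ℂ} {x : ℝ × ℝ} (hf : DifferentiableAt ℝ f x)
    (hg : DifferentiableAt ℝ g x) :
    dy (fun y => f y * g y) x = dy f x * g x + f x * dy g x := by
  simp only [dy, fderiv_fun_mul hf hg, _root_.add_apply,
    _root_.smul_apply, smul_eq_mul]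
  ring

lemma dz_mul {f g : ℝ × ℝ → ℂ} {x : ℝ × ℝ} (hf : DifferentiableAt ℝ f x)
    (hg : DifferentiableAt ℝ g x) :
    dz (fun y => f y * g y) x = dz f x * g x + f x * dz g x := by
  simp only [dz, fderiv_fun_mul hf hg, _root_.add_apply,
    _root_.smul_apply, smul_eq_mul]
  ring

/-- Chain rule for a function of a real field. -/
lemma fderiv_comp_real_apply {φ : ℝ → ℂ} {f : ℝ × ℝ → ℝ} {x : ℝ × ℝ} {φ' : ℂ}
    (hφ : HasDerivAt φ φ' (f x)) (hf : DifferentiableAt ℝ f x) (v : ℝ × ℝ) :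
    fderiv ℝ (fun y => φ (f y)) x v = φ' * (fderiv ℝ f x v : ℝ) := by
  have := (hφ.hasFDerivAt.comp x hf.hasFDerivAt).fderiv
  rw [show (fun y => φ (f y)) = φ ∘ f from rfl, this]
  simp [mul_comm]

lemma hasDerivAt_sub_const_ofReal (c : ℂ) (t : ℝ) :
    HasDerivAt (fun t : ℝ => (t : ℂ) - c) 1 t := by
  simpa using (Complex.ofRealCLM.hasDerivAt (x := t)).sub_const c

lemma dy_ofReal {f : ℝ × ℝ → ℝ} {x : ℝ × ℝ} (hf : DifferentiableAt ℝ f x) :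
    dy (fun y => (f y : ℂ)) x = dy f x := by
  simpa [dy] using fderiv_comp_real_apply (φ := fun t => (t : ℂ) - 0)
    (hasDerivAt_sub_const_ofReal 0 _) hf (1, 0)

lemma dz_ofReal {f : ℝ × ℝ → ℝ} {x : ℝ × ℝ} (hf : DifferentiableAt ℝ f x) :
    dz (fun y => (f y : ℂ)) x = dz f x := by
  simpa [dz] using fderiv_comp_real_apply (φ := fun t => (t : ℂ) - 0)
    (hasDerivAt_sub_const_ofReal 0 _) hf (0, 1)

lemma dy_const_mul {f : ℝ × ℝ → ℂ} {x : ℝ × ℝ} (hf : DifferentiableAt ℝ f x) (b : ℂ) :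
    dy (fun y => b * f y) x = b * dy f x := by
  simp [dy, fderiv_const_mul hf b]

lemma dz_const_mul {f : ℝ × ℝ → ℂ} {x : ℝ × ℝ} (hf : DifferentiableAt ℝ f x) (b : ℂ) :
    dz (fun y => b * f y) x = b * dz f x := by
  simp [dz, fderiv_const_mul hf b]

/-! ### Reduction of the linearised equations to the displacement. -/

lemma shifted_im (S : BaseState) (c : ℂ) (x : ℝ × ℝ) : (shifted S c x).im = -c.im := by
  simp [shifted]

lemma shifted_re (S : BaseState) (c : ℂ) (x : ℝ × ℝ) : (shifted S c x).re = S.u x - c.re := by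
  simp [shifted]

lemma shifted_ne_zero (S : BaseState) {c : ℂ} (hc : c.im ≠ 0) (x : ℝ × ℝ) :
    shifted S c x ≠ 0 := by
  intro h
  have := shifted_im S c x
  rw [h] at this
  exact hc (by simpa using this)

/-- A complex number with nonzero imaginary part keeps away from the real sound speeds. -/
lemma im_sq_le_norm_sq_sub_sq (s : ℝ) (U : ℂ) : U.im ^ 2 ≤ ‖(s : ℂ) ^ 2 - U ^ 2‖ := by
  rw [show (s : ℂ) ^ 2 - U ^ 2 = (s - U) * (s + U) by ring, norm_mul, ← sq_abs, sq]
  gcongr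
  · simpa using Complex.abs_im_le_norm ((s : ℂ) - U)
  · simpa using Complex.abs_im_le_norm ((s : ℂ) + U)

lemma sq_sub_shifted_sq_ne_zero (S : BaseState) {c : ℂ} (hc : c.im ≠ 0) (x : ℝ × ℝ) :
    (S.s x : ℂ) ^ 2 - shifted S c x ^ 2 ≠ 0 := by
  have h := im_sq_le_norm_sq_sub_sq (S.s x) (shifted S c x)
  rw [shifted_im] at h
  have : 0 < c.im ^ 2 := by positivity
  exact norm_pos_iff.1 (by nlinarith)

/-- The divergence of the displacement. -/
def Perturbation.δ (w : Perturbation) (S : BaseState) (k : ℝ) (c : ℂ) (x : ℝ × ℝ) : ℂ :=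
  dy (w.η S k c) x + dz (w.ζ S k c) x

/-- The reduced compression `(s² δ + ξ · ∇G) / (s² - U²)`, with `ξ = (η, ζ)`. -/
def Perturbation.P (w : Perturbation) (S : BaseState) (k : ℝ) (c : ℂ) (x : ℝ × ℝ) : ℂ :=
  ((S.s x : ℂ) ^ 2 * w.δ S k c x + (dy S.G x * w.η S k c x + dz S.G x * w.ζ S k c x))
    / ((S.s x : ℂ) ^ 2 - shifted S c x ^ 2)

lemma CrossSection.IsBoundedC1.differentiableAt {R : CrossSection} {f : ℝ × ℝ → ℝ}
    (hf : R.IsBoundedC1 f) {x : ℝ × ℝ} (hx : x ∈ R.D) : DifferentiableAt ℝ f x :=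
  (hf.1.differentiableOn one_ne_zero).differentiableAt (R.isOpen_D.mem_nhds hx)

lemma contDiffOn_shifted {R : CrossSection} {S : BaseState} (hS : S.IsAdmissible R) (c : ℂ) :
    ContDiffOn ℝ 1 (shifted S c) R.D :=
  (Complex.ofRealCLM.contDiff.comp_contDiffOn hS.u_reg.1).sub contDiffOn_const

lemma IsNormalMode.contDiffOn_η {R : CrossSection} {S : BaseState} {k : ℝ} {c : ℂ}
    {w : Perturbation} (hw : IsNormalMode R S k c w) (hS : S.IsAdmissible R) (hk : k ≠ 0)
    (hc : c.im ≠ 0) : ContDiffOn ℝ 1 (w.η S k c) R.D := by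
  refine (hw.vy_reg.mul ((contDiffOn_const.mul (contDiffOn_shifted hS c)).inv fun x _ => ?_)).congr
    fun x _ => div_eq_mul_inv _ _
  have := shifted_ne_zero S hc x
  have : (k : ℂ) ≠ 0 := by exact_mod_cast hk
  simp_all

lemma IsNormalMode.contDiffOn_ζ {R : CrossSection} {S : BaseState} {k : ℝ} {c : ℂ}
    {w : Perturbation} (hw : IsNormalMode R S k c w) (hS : S.IsAdmissible R) (hk : k ≠ 0)
    (hc : c.im ≠ 0) : ContDiffOn ℝ 1 (w.ζ S k c) R.D := by
  refine (hw.vz_reg.mul ((contDiffOn_const.mul (contDiffOn_shifted hS c)).inv fun x _ => ?_)).congr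
    fun x _ => div_eq_mul_inv _ _
  have := shifted_ne_zero S hc x
  have : (k : ℂ) ≠ 0 := by exact_mod_cast hk
  simp_all

/-- Elimination of the streamwise components from the linearised equations. -/
lemma eliminate_streamwise {K U ρ m B s2 a2 η ζ ηy ζz uy uz By Bz ry rz gy gz P vx bx r q : ℂ}
    (hK : K ≠ 0) (hU : U ≠ 0) (hρ : ρ ≠ 0) (hm : m ≠ 0) (hs : s2 - U ^ 2 ≠ 0)
    (ha : a2 * (m * ρ) = B ^ 2)
    (hP : P = (s2 * (ηy + ζz) + (gy * η + gz * ζ)) / (s2 - U ^ 2))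
    (momentum : ρ * (U * K * vx + (K * U * η * uy + K * U * ζ * uz))
      - 1 / m * (B * K * bx + (K * B * η * By + K * B * ζ * Bz)) + K * q = 0)
    (gauss : K * bx + K * (By * η + B * ηy) + K * (Bz * ζ + B * ζz) = 0)
    (mass : U * K * r + (K * U * η * ry + K * U * ζ * rz)
      + ρ * (K * vx + K * (uy * η + U * ηy) + K * (uz * ζ + U * ζz)) = 0)
    (energy : U * K * (s2 * r + B * bx / m - q)
      + K * U * η * (s2 * ry + B * By / m - gy * ρ)
      + K * U * ζ * (s2 * rz + B * Bz / m - gz * ρ) = 0) :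
    bx = -(By * η + Bz * ζ + B * (ηy + ζz)) ∧
    vx = -(η * uy + ζ * uz) - U * P ∧
    q = ρ * (U ^ 2 * P - a2 * (ηy + ζz)) ∧
    r = ρ * (P - (ηy + ζz)) - (η * ry + ζ * rz) := by
  have hbx : bx = -(By * η + Bz * ζ + B * (ηy + ζz)) := by
    apply mul_left_cancel₀ hK
    linear_combination gauss
  obtain rfl : B ^ 2 / (m * ρ) = a2 := by rw [← ha]; field_simp
  -- X is the Lagrangian perturbation of the streamwise velocity; in it the gradients of u drop out
  -- of momentum and mass, and the magnetic terms then cancel from the energy equation.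
  set X := vx + (η * uy + ζ * uz) with hX
  have hvx : vx = X - (η * uy + ζ * uz) := by rw [hX]; ring
  have hq : q = -ρ * U * X - B ^ 2 / m * (ηy + ζz) := by
    apply mul_left_cancel₀ hK
    rw [hvx, hbx] at momentum
    linear_combination momentum
  have hr : U * r = -U * (η * ry + ζ * rz) - ρ * (X + U * (ηy + ζz)) := by
    apply mul_left_cancel₀ hK
    rw [hvx] at mass
    linear_combination mass
  have hE : s2 * (U * r) + U * s2 * (η * ry + ζ * rz) + ρ * U ^ 2 * X
      - U * ρ * (gy * η + gz * ζ) = 0 := by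
    apply mul_left_cancel₀ hK
    rw [hbx, hq] at energy
    linear_combination energy
  -- The energy equation has become (s² - U²)X = -U(s²δ + ξ·∇G), which is solvable away from the
  -- sound speeds.
  have hXP : X = -U * P := by
    have h1 : ρ * ((s2 - U ^ 2) * X + U * (s2 * (ηy + ζz) + (gy * η + gz * ζ))) = 0 := by
      rw [hr] at hE
      linear_combination -hE
    have h2 := (mul_eq_zero.1 h1).resolve_left hρ
    rw [hP]
    field_simp
    linear_combination h2
  refine ⟨hbx, by rw [hvx, hXP]; ring, ?_, ?_⟩
  · rw [hq, hXP]; field_simp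
  · apply mul_left_cancel₀ hU
    rw [hr, hXP]; ring

lemma BaseState.IsAdmissible.ρ_pos' {R : CrossSection} {S : BaseState} (hS : S.IsAdmissible R)
    {x : ℝ × ℝ} (hx : x ∈ R.D) : 0 < S.ρ x := by
  obtain ⟨ε, hε, h⟩ := hS.ρ_pos
  exact hε.trans_le (h x hx)

lemma BaseState.IsAdmissible.s_sq_pos {R : CrossSection} {S : BaseState} (hS : S.IsAdmissible R)
    {x : ℝ × ℝ} (hx : x ∈ R.D) : 0 < S.s x ^ 2 := by
  obtain ⟨ε, hε, h⟩ := hS.p_pos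
  have hp : 0 < S.p x := hε.trans_le (h x hx)
  have := Real.sqrt_pos.2 (div_pos (mul_pos hS.γ_pos hp) (hS.ρ_pos' hx))
  exact pow_pos this 2

lemma BaseState.IsAdmissible.a_sq {R : CrossSection} {S : BaseState} (hS : S.IsAdmissible R)
    {x : ℝ × ℝ} (hx : x ∈ R.D) : S.a x ^ 2 = S.B x ^ 2 / (S.μ₀ * S.ρ x) := by
  rw [BaseState.a, div_pow, Real.sq_sqrt (mul_pos hS.μ₀_pos (hS.ρ_pos' hx)).le]

lemma BaseState.IsAdmissible.s_sq {R : CrossSection} {S : BaseState} (hS : S.IsAdmissible R)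
    {x : ℝ × ℝ} (hx : x ∈ R.D) : S.s x ^ 2 = S.γ * S.p x / S.ρ x := by
  obtain ⟨ε, hε, h⟩ := hS.p_pos
  have hp : 0 < S.p x := hε.trans_le (h x hx)
  exact Real.sq_sqrt (div_pos (mul_pos hS.γ_pos hp) (hS.ρ_pos' hx)).le

section Mode

variable {R : CrossSection} {S : BaseState} {k : ℝ} {c : ℂ} {w : Perturbation}

lemma Perturbation.vy_eq (S : BaseState) (hk : k ≠ 0) (hc : c.im ≠ 0) (x : ℝ × ℝ) :
    w.vy x = Complex.I * k * (shifted S c x * w.η S k c x) := by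
  have := shifted_ne_zero S hc x
  have : (k : ℂ) ≠ 0 := by exact_mod_cast hk
  have := Complex.I_ne_zero
  rw [Perturbation.η]
  field_simp

lemma Perturbation.vz_eq (S : BaseState) (hk : k ≠ 0) (hc : c.im ≠ 0) (x : ℝ × ℝ) :
    w.vz x = Complex.I * k * (shifted S c x * w.ζ S k c x) := by
  have := shifted_ne_zero S hc x
  have : (k : ℂ) ≠ 0 := by exact_mod_cast hk
  have := Complex.I_ne_zero
  rw [Perturbation.ζ]
  field_simp

lemma IsNormalMode.bY_eq (hw : IsNormalMode R S k c w) (hk : k ≠ 0) (hc : c.im ≠ 0)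
    {x : ℝ × ℝ} (hx : x ∈ R.D) : w.bY x = Complex.I * k * ((S.B x : ℂ) * w.η S k c x) := by
  have hk' : (k : ℂ) ≠ 0 := by exact_mod_cast hk
  have h := (hw.solves x hx).induction_y
  rw [Perturbation.vy_eq S hk hc] at h
  apply mul_left_cancel₀ (mul_ne_zero (shifted_ne_zero S hc x) (mul_ne_zero Complex.I_ne_zero hk'))
  linear_combination h

lemma IsNormalMode.bz_eq (hw : IsNormalMode R S k c w) (hk : k ≠ 0) (hc : c.im ≠ 0)
    {x : ℝ × ℝ} (hx : x ∈ R.D) : w.bz x = Complex.I * k * ((S.B x : ℂ) * w.ζ S k c x) := by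
  have hk' : (k : ℂ) ≠ 0 := by exact_mod_cast hk
  have h := (hw.solves x hx).induction_z
  rw [Perturbation.vz_eq S hk hc] at h
  apply mul_left_cancel₀ (mul_ne_zero (shifted_ne_zero S hc x) (mul_ne_zero Complex.I_ne_zero hk'))
  linear_combination h

lemma dy_shifted (hS : S.IsAdmissible R) (c : ℂ) {x : ℝ × ℝ} (hx : x ∈ R.D) :
    dy (shifted S c) x = dy S.u x := by
  simpa [dy, show shifted S c = fun y => (S.u y : ℂ) - c from rfl] using
    fderiv_comp_real_apply (hasDerivAt_sub_const_ofReal c _)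
    (hS.u_reg.differentiableAt hx) (1, 0)

lemma dz_shifted (hS : S.IsAdmissible R) (c : ℂ) {x : ℝ × ℝ} (hx : x ∈ R.D) :
    dz (shifted S c) x = dz S.u x := by
  simpa [dz, show shifted S c = fun y => (S.u y : ℂ) - c from rfl] using
    fderiv_comp_real_apply (hasDerivAt_sub_const_ofReal c _)
    (hS.u_reg.differentiableAt hx) (0, 1)

/-- All amplitudes in terms of the displacement. -/
lemma IsNormalMode.amplitudes (hw : IsNormalMode R S k c w) (hS : S.IsAdmissible R) (hk : k ≠ 0)
    (hc : c.im ≠ 0) {x : ℝ × ℝ} (hx : x ∈ R.D) :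
    w.bx x = -(dy S.B x * w.η S k c x + dz S.B x * w.ζ S k c x + S.B x * w.δ S k c x) ∧
    w.vx x = -(w.η S k c x * dy S.u x + w.ζ S k c x * dz S.u x)
      - shifted S c x * w.P S k c x ∧
    w.q x = S.ρ x * (shifted S c x ^ 2 * w.P S k c x - (S.a x ^ 2 : ℝ) * w.δ S k c x) ∧
    w.ρ x = S.ρ x * (w.P S k c x - w.δ S k c x)
      - (w.η S k c x * dy S.ρ x + w.ζ S k c x * dz S.ρ x) := by
  have hk' : (k : ℂ) ≠ 0 := by exact_mod_cast hk
  have hn := R.isOpen_D.mem_nhds hx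
  have dη : DifferentiableAt ℝ (w.η S k c) x :=
    ((hw.contDiffOn_η hS hk hc).differentiableOn one_ne_zero).differentiableAt hn
  have dζ : DifferentiableAt ℝ (w.ζ S k c) x :=
    ((hw.contDiffOn_ζ hS hk hc).differentiableOn one_ne_zero).differentiableAt hn
  have dU : DifferentiableAt ℝ (shifted S c) x :=
    ((contDiffOn_shifted hS c).differentiableOn one_ne_zero).differentiableAt hn
  have dB : DifferentiableAt ℝ (fun y => (S.B y : ℂ)) x :=
    Complex.ofRealCLM.differentiableAt.comp x (hS.B_reg.differentiableAt hx)
  have hvy : dy w.vy x = Complex.I * k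
      * (dy S.u x * w.η S k c x + shifted S c x * dy (w.η S k c) x) := by
    rw [funext (Perturbation.vy_eq (w := w) S hk hc), dy_const_mul (dU.fun_mul dη), dy_mul dU dη,
      dy_shifted hS c hx]
  have hvz : dz w.vz x = Complex.I * k
      * (dz S.u x * w.ζ S k c x + shifted S c x * dz (w.ζ S k c) x) := by
    rw [funext (Perturbation.vz_eq (w := w) S hk hc), dz_const_mul (dU.fun_mul dζ), dz_mul dU dζ,
      dz_shifted hS c hx]
  have hby : dy w.bY x = Complex.I * k
      * (dy S.B x * w.η S k c x + S.B x * dy (w.η S k c) x) := by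
    have : w.bY =ᶠ[𝓝 x] fun y => Complex.I * k * ((S.B y : ℂ) * w.η S k c y) := by
      filter_upwards [hn] with y hy using hw.bY_eq hk hc hy
    rw [dy, this.fderiv_eq, ← dy, dy_const_mul (dB.fun_mul dη), dy_mul dB dη,
      dy_ofReal (hS.B_reg.differentiableAt hx)]
  have hbz : dz w.bz x = Complex.I * k
      * (dz S.B x * w.ζ S k c x + S.B x * dz (w.ζ S k c) x) := by
    have : w.bz =ᶠ[𝓝 x] fun y => Complex.I * k * ((S.B y : ℂ) * w.ζ S k c y) := by
      filter_upwards [hn] with y hy using hw.bz_eq hk hc hy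
    rw [dz, this.fderiv_eq, ← dz, dz_const_mul (dB.fun_mul dζ), dz_mul dB dζ,
      dz_ofReal (hS.B_reg.differentiableAt hx)]
  have hρ : (S.ρ x : ℂ) ≠ 0 := by exact_mod_cast (hS.ρ_pos' hx).ne'
  have hm : (S.μ₀ : ℂ) ≠ 0 := by exact_mod_cast hS.μ₀_pos.ne'
  have ha : ((S.a x ^ 2 : ℝ) : ℂ) * (S.μ₀ * S.ρ x) = (S.B x : ℂ) ^ 2 := by
    rw [hS.a_sq hx]; push_cast; field_simp
  obtain ⟨h1, -, -, h4, -, -, h7, h8, h9⟩ := hw.solves x hx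
  rw [hby, hbz] at h7
  rw [hvy, hvz] at h8
  rw [hw.bY_eq hk hc hx, hw.bz_eq hk hc hx] at h1
  rw [Perturbation.vy_eq S hk hc, Perturbation.vz_eq S hk hc] at h1 h8 h9
  refine eliminate_streamwise (K := Complex.I * k) (m := S.μ₀)
    (mul_ne_zero Complex.I_ne_zero hk') (shifted_ne_zero S hc x) hρ hm
    (sq_sub_shifted_sq_ne_zero S hc x) ha rfl ?_ ?_ ?_ ?_
  · linear_combination h1
  · linear_combination h7
  · linear_combination h8
  · linear_combination h9

/-- The transverse momentum equations in terms of the displacement. -/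
lemma IsNormalMode.grad_q (hw : IsNormalMode R S k c w) (hS : S.IsAdmissible R) (hk : k ≠ 0)
    (hc : c.im ≠ 0) {x : ℝ × ℝ} (hx : x ∈ R.D) :
    dy w.q x = k ^ 2 * S.ρ x * (shifted S c x ^ 2 - (S.a x ^ 2 : ℝ)) * w.η S k c x
      + dy S.G x * w.ρ x ∧
    dz w.q x = k ^ 2 * S.ρ x * (shifted S c x ^ 2 - (S.a x ^ 2 : ℝ)) * w.ζ S k c x
      + dz S.G x * w.ρ x := by
  have hρ : (S.ρ x : ℂ) ≠ 0 := by exact_mod_cast (hS.ρ_pos' hx).ne'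
  have hm : (S.μ₀ : ℂ) ≠ 0 := by exact_mod_cast hS.μ₀_pos.ne'
  have ha : (S.ρ x : ℂ) * ((S.a x ^ 2 : ℝ) : ℂ) = 1 / S.μ₀ * (S.B x : ℂ) ^ 2 := by
    rw [hS.a_sq hx]; push_cast; field_simp
  have h2 := (hw.solves x hx).momentum_y
  have h3 := (hw.solves x hx).momentum_z
  rw [hw.bY_eq hk hc hx, Perturbation.vy_eq S hk hc] at h2
  rw [hw.bz_eq hk hc hx, Perturbation.vz_eq S hk hc] at h3
  constructor
  · linear_combination h2 + k ^ 2 * w.η S k c x * ha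
      - k ^ 2 * w.η S k c x * (S.ρ x * shifted S c x ^ 2 - 1 / S.μ₀ * S.B x ^ 2) * Complex.I_sq
  · linear_combination h3 + k ^ 2 * w.ζ S k c x * ha
      - k ^ 2 * w.ζ S k c x * (S.ρ x * shifted S c x ^ 2 - 1 / S.μ₀ * S.B x ^ 2) * Complex.I_sq

end Mode

/-- In magnetostatic equilibrium the gradients of density and potential are parallel. -/
lemma BaseState.IsAdmissible.parallel {R : CrossSection} {S : BaseState} (hS : S.IsAdmissible R)
    {x : ℝ × ℝ} (hx : x ∈ R.D) : dz S.G x * dy S.ρ x = dy S.G x * dz S.ρ x := by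
  have hn := R.isOpen_D.mem_nhds hx
  have dG : ∀ y ∈ R.D, DifferentiableAt ℝ S.G y := fun y hy =>
    (hS.G_reg.differentiableOn two_ne_zero).differentiableAt (R.isOpen_D.mem_nhds hy)
  have dG' : DifferentiableAt ℝ (fderiv ℝ S.G) x :=
    ((hS.G_reg.fderiv_of_isOpen (m := 1) R.isOpen_D (by norm_num)).differentiableOn
      one_ne_zero).differentiableAt hn
  have dρ := hS.ρ_reg.differentiableAt hx
  have hG := second_derivative_symmetric_of_eventually_of_real
    (by filter_upwards [hn] with y hy using (dG y hy).hasFDerivAt) dG'.hasFDerivAt (1, 0) (0, 1)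
  have hq' : ∀ y ∈ R.D, HasFDerivAt S.q (S.ρ y • fderiv ℝ S.G y) y := by
    intro y hy
    have h := (hS.q_reg.differentiableAt hy).hasFDerivAt
    convert h using 1
    have h1 := hS.magnetostatic_y y hy
    have h2 := hS.magnetostatic_z y hy
    ext
    · simp only [dy] at h1
      simp; linarith
    · simp only [dz] at h2
      simp; linarith
  -- The second derivative of q is ρD²G + dρ ⊗ dG. Symmetry of both Hessians leaves the symmetry of
  -- dρ ⊗ dG, that is, the vanishing of the curl of ρ∇G.
  have hq := second_derivative_symmetric_of_eventually_of_real
    (by filter_upwards [hn] with y hy using hq' y hy)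
    (dρ.hasFDerivAt.smul dG'.hasFDerivAt) (1, 0) (0, 1)
  simp only [_root_.add_apply, _root_.smul_apply, smul_eq_mul,
    ContinuousLinearMap.smulRight_apply, hG] at hq
  simp only [dy, dz]
  linarith

/-! ### Bounded coefficients and square integrability over one period. -/

/-- Bounded continuous fields on the cross-section. -/
def CrossSection.BddCont (R : CrossSection) {E : Type*} [NormedAddCommGroup E]
    (b : ℝ × ℝ → E) : Prop :=
  ContinuousOn b R.D ∧ ∃ C : ℝ, ∀ x ∈ R.D, ‖b x‖ ≤ C

namespace CrossSection

variable {R : CrossSection}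

lemma BddCont.const {E : Type*} [NormedAddCommGroup E] (e : E) : R.BddCont fun _ => e :=
  ⟨continuousOn_const, ‖e‖, fun _ _ => le_rfl⟩

lemma BddCont.add {E : Type*} [NormedAddCommGroup E] {f g : ℝ × ℝ → E} (hf : R.BddCont f)
    (hg : R.BddCont g) : R.BddCont fun x => f x + g x := by
  obtain ⟨C, hC⟩ := hf.2
  obtain ⟨C', hC'⟩ := hg.2
  exact ⟨hf.1.add hg.1, C + C',
    fun x hx => (norm_add_le _ _).trans (add_le_add (hC x hx) (hC' x hx))⟩

lemma BddCont.sub {E : Type*} [NormedAddCommGroup E] {f g : ℝ × ℝ → E} (hf : R.BddCont f)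
    (hg : R.BddCont g) : R.BddCont fun x => f x - g x := by
  obtain ⟨C, hC⟩ := hf.2
  obtain ⟨C', hC'⟩ := hg.2
  exact ⟨hf.1.sub hg.1, C + C',
    fun x hx => (norm_sub_le _ _).trans (add_le_add (hC x hx) (hC' x hx))⟩

lemma BddCont.mul {A : Type*} [NormedRing A] {f g : ℝ × ℝ → A} (hf : R.BddCont f)
    (hg : R.BddCont g) : R.BddCont fun x => f x * g x := by
  obtain ⟨C, hC⟩ := hf.2
  obtain ⟨C', hC'⟩ := hg.2
  exact ⟨hf.1.mul hg.1, C * C', fun x hx => (norm_mul_le _ _).trans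
    (mul_le_mul (hC x hx) (hC' x hx) (norm_nonneg _) ((norm_nonneg _).trans (hC x hx)))⟩

lemma BddCont.pow {A : Type*} [NormedRing A] {f : ℝ × ℝ → A} (hf : R.BddCont f) (n : ℕ) :
    R.BddCont fun x => f x ^ n := by
  induction n with
  | zero => simpa using BddCont.const (1 : A)
  | succ n ih => simpa only [pow_succ] using ih.mul hf

lemma BddCont.inv {K : Type*} [NormedField K] {f : ℝ × ℝ → K} (hf : R.BddCont f) {ε : ℝ}
    (hε : 0 < ε) (h : ∀ x ∈ R.D, ε ≤ ‖f x‖) : R.BddCont fun x => (f x)⁻¹ := by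
  refine ⟨hf.1.inv₀ fun x hx => norm_pos_iff.1 (hε.trans_le (h x hx)), ε⁻¹, fun x hx => ?_⟩
  rw [norm_inv]
  exact inv_anti₀ hε (h x hx)

lemma BddCont.ofReal {f : ℝ × ℝ → ℝ} (hf : R.BddCont f) : R.BddCont fun x => (f x : ℂ) := by
  obtain ⟨C, hC⟩ := hf.2
  exact ⟨Complex.continuous_ofReal.comp_continuousOn hf.1, C, fun x hx => by simpa using hC x hx⟩

/-- A bounded real field takes values in a compact interval, so no global bound on φ is needed. This
is how weights that depend on u enter. -/
lemma BddCont.comp {E : Type*} [NormedAddCommGroup E] {f : ℝ × ℝ → ℝ} (hf : R.BddCont f)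
    {φ : ℝ → E} (hφ : Continuous φ) : R.BddCont fun x => φ (f x) := by
  obtain ⟨C, hC⟩ := hf.2
  obtain ⟨M, hM⟩ := (isCompact_Icc (a := -C) (b := C)).exists_bound_of_continuousOn hφ.continuousOn
  exact ⟨hφ.comp_continuousOn hf.1, M, fun x hx => hM _ (abs_le.1 (hC x hx))⟩

lemma BddCont.congr {E : Type*} [NormedAddCommGroup E] {f g : ℝ × ℝ → E} (hf : R.BddCont f)
    (h : ∀ x ∈ R.D, g x = f x) : R.BddCont g := by
  obtain ⟨C, hC⟩ := hf.2
  exact ⟨hf.1.congr h, C, fun x hx => by rw [h x hx]; exact hC x hx⟩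

lemma ContDiffOn.continuousOn_dy {E : Type*} [NormedAddCommGroup E] [NormedSpace ℝ E]
    {f : ℝ × ℝ → E} {n : WithTop ℕ∞} (hf : ContDiffOn ℝ n f R.D) (hn : 1 ≤ n) :
    ContinuousOn (dy f) R.D :=
  (hf.continuousOn_fderiv_of_isOpen R.isOpen_D hn).clm_apply continuousOn_const

lemma ContDiffOn.continuousOn_dz {E : Type*} [NormedAddCommGroup E] [NormedSpace ℝ E]
    {f : ℝ × ℝ → E} {n : WithTop ℕ∞} (hf : ContDiffOn ℝ n f R.D) (hn : 1 ≤ n) :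
    ContinuousOn (dz f) R.D :=
  (hf.continuousOn_fderiv_of_isOpen R.isOpen_D hn).clm_apply continuousOn_const

lemma IsBoundedC1.bddCont {f : ℝ × ℝ → ℝ} (hf : R.IsBoundedC1 f) : R.BddCont f := by
  obtain ⟨C, hC⟩ := hf.2
  exact ⟨hf.1.continuousOn, C, fun x hx => (hC x hx).1⟩

lemma IsBoundedC1.bddCont_dy {f : ℝ × ℝ → ℝ} (hf : R.IsBoundedC1 f) : R.BddCont (dy f) := by
  obtain ⟨C, hC⟩ := hf.2
  exact ⟨ContDiffOn.continuousOn_dy hf.1 le_rfl, C, fun x hx => (hC x hx).2.1⟩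

lemma IsBoundedC1.bddCont_dz {f : ℝ × ℝ → ℝ} (hf : R.IsBoundedC1 f) : R.BddCont (dz f) := by
  obtain ⟨C, hC⟩ := hf.2
  exact ⟨ContDiffOn.continuousOn_dz hf.1 le_rfl, C, fun x hx => (hC x hx).2.2⟩

/-- The measure of integration over one period. -/
abbrev cellMeasure (R : CrossSection) : Measure (ℝ × ℝ) := volume.restrict R.cell

lemma cellMeasure_le : R.cellMeasure ≤ volume.restrict R.D :=
  Measure.restrict_mono R.cell_subset le_rfl

/-- The period cell is not assumed to be Borel; the open set D supplies the measurability. -/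
lemma ae_mem_D (R : CrossSection) : ∀ᵐ x ∂(R.cellMeasure), x ∈ R.D :=
  ae_mono cellMeasure_le (ae_restrict_mem R.isOpen_D.measurableSet)

lemma BddCont.aestronglyMeasurable {E : Type*} [NormedAddCommGroup E]
    [SecondCountableTopology E] {b : ℝ × ℝ → E} (hb : R.BddCont b) :
    AEStronglyMeasurable b R.cellMeasure :=
  (hb.1.aestronglyMeasurable R.isOpen_D.measurableSet).mono_measure cellMeasure_le

lemma BddCont.ae_bound {E : Type*} [NormedAddCommGroup E] {b : ℝ × ℝ → E} (hb : R.BddCont b) :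
    ∃ C : ℝ, ∀ᵐ x ∂(R.cellMeasure), ‖b x‖ ≤ C := by
  obtain ⟨C, hC⟩ := hb.2
  exact ⟨C, (R.ae_mem_D).mono hC⟩

lemma BddCont.mul_memLp {b f : ℝ × ℝ → ℂ} (hb : R.BddCont b) (hf : MemLp f 2 R.cellMeasure) :
    MemLp (fun x => b x * f x) 2 R.cellMeasure := by
  obtain ⟨C, hC⟩ := hb.ae_bound
  refine hf.of_le_mul (c := C) (hb.aestronglyMeasurable.mul hf.1) ?_
  filter_upwards [hC] with x hx
  rw [norm_mul]
  gcongr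

lemma BddCont.mul_integrable {b f : ℝ × ℝ → ℝ} (hb : R.BddCont b)
    (hf : Integrable f R.cellMeasure) : Integrable (fun x => b x * f x) R.cellMeasure := by
  obtain ⟨C, hC⟩ := hb.ae_bound
  exact hf.bdd_mul hb.aestronglyMeasurable hC

end CrossSection

lemma integrable_normSq {R : CrossSection} {f : ℝ × ℝ → ℂ} (hf : MemLp f 2 R.cellMeasure) :
    Integrable (fun x => normSq (f x)) R.cellMeasure := by
  have := hf.integrable_norm_pow (p := 2) two_ne_zero
  simpa only [Complex.normSq_eq_norm_sq] using this

lemma integrable_mul_of_memLp {R : CrossSection} {f g : ℝ × ℝ → ℂ} (hf : MemLp f 2 R.cellMeasure)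
    (hg : MemLp g 2 R.cellMeasure) : Integrable (fun x => f x * g x) R.cellMeasure :=
  hf.integrable_mul hg

lemma memLp_conj {R : CrossSection} {f : ℝ × ℝ → ℂ} (hf : MemLp f 2 R.cellMeasure) :
    MemLp (fun x => conj (f x)) 2 R.cellMeasure := hf.star

namespace BaseState.IsAdmissible

variable {R : CrossSection} {S : BaseState} (hS : S.IsAdmissible R)
include hS

lemma bddCont_inv_ρ : R.BddCont fun x => (S.ρ x)⁻¹ := by
  obtain ⟨ε, hε, h⟩ := hS.ρ_pos
  exact hS.ρ_reg.bddCont.inv hε fun x hx => (h x hx).trans (le_abs_self _)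

lemma bddCont_p : R.BddCont S.p :=
  hS.q_reg.bddCont.sub (((hS.B_reg.bddCont.pow 2).mul (.const (2 * S.μ₀)⁻¹)).congr
    fun _ _ => div_eq_mul_inv _ _)

lemma bddCont_s_sq : R.BddCont fun x => S.s x ^ 2 :=
  (((CrossSection.BddCont.const S.γ).mul hS.bddCont_p).mul hS.bddCont_inv_ρ).congr fun x hx => by
    rw [hS.s_sq hx, div_eq_mul_inv]

lemma bddCont_inv_s_sq : R.BddCont fun x => (S.s x ^ 2)⁻¹ := by
  obtain ⟨ε, hε, h⟩ := hS.p_pos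
  have hp : R.BddCont fun x => (S.p x)⁻¹ :=
    hS.bddCont_p.inv hε fun x hx => (h x hx).trans (le_abs_self _)
  refine ((hS.ρ_reg.bddCont.mul (.const S.γ⁻¹)).mul hp).congr fun x hx => ?_
  rw [hS.s_sq hx, inv_div, div_eq_mul_inv, mul_inv, mul_assoc]

lemma bddCont_a_sq : R.BddCont fun x => S.a x ^ 2 := by
  refine (((hS.B_reg.bddCont.pow 2).mul (.const S.μ₀⁻¹)).mul hS.bddCont_inv_ρ).congr
    fun x hx => ?_
  rw [hS.a_sq hx, div_eq_mul_inv, mul_inv, mul_assoc]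

lemma bddCont_dyG : R.BddCont (dy S.G) := by
  obtain ⟨C, hC⟩ := hS.G_bdd
  exact ⟨CrossSection.ContDiffOn.continuousOn_dy hS.G_reg one_le_two, C, fun x hx => (hC x hx).1⟩

lemma bddCont_dzG : R.BddCont (dz S.G) := by
  obtain ⟨C, hC⟩ := hS.G_bdd
  exact ⟨CrossSection.ContDiffOn.continuousOn_dz hS.G_reg one_le_two, C, fun x hx => (hC x hx).2⟩

lemma bddCont_N1sq : R.BddCont S.N1sq :=
  (((hS.bddCont_dyG.mul hS.ρ_reg.bddCont_dy).mul hS.bddCont_inv_ρ).sub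
    ((hS.bddCont_dyG.pow 2).mul hS.bddCont_inv_s_sq)).congr fun x _ => by
      simp only [BaseState.N1sq, div_eq_mul_inv]

lemma bddCont_N2sq : R.BddCont S.N2sq :=
  (((hS.bddCont_dzG.mul hS.ρ_reg.bddCont_dz).mul hS.bddCont_inv_ρ).sub
    ((hS.bddCont_dzG.pow 2).mul hS.bddCont_inv_s_sq)).congr fun x _ => by
      simp only [BaseState.N2sq, div_eq_mul_inv]

lemma bddCont_N12sq : R.BddCont S.N12sq :=
  (((hS.bddCont_dzG.mul hS.ρ_reg.bddCont_dy).mul hS.bddCont_inv_ρ).sub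
    ((hS.bddCont_dyG.mul hS.bddCont_dzG).mul hS.bddCont_inv_s_sq)).congr fun x _ => by
      simp only [BaseState.N12sq, div_eq_mul_inv]

lemma bddCont_shearSq : R.BddCont S.shearSq :=
  (hS.u_reg.bddCont_dy.pow 2).add (hS.u_reg.bddCont_dz.pow 2)

lemma bddCont_misalignment : R.BddCont (S.misalignment R) := by
  have hT : R.BddCont fun x => S.N1sq x + S.N2sq x - S.Jm R * S.shearSq x :=
    (hS.bddCont_N1sq.add hS.bddCont_N2sq).sub (.mul (.const _) hS.bddCont_shearSq)
  have hX : R.BddCont fun x => dz S.u x ^ 2 * S.N1sq x + dy S.u x ^ 2 * S.N2sq x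
      - 2 * dy S.u x * dz S.u x * S.N12sq x :=
    (((hS.u_reg.bddCont_dz.pow 2).mul hS.bddCont_N1sq).add
      ((hS.u_reg.bddCont_dy.pow 2).mul hS.bddCont_N2sq)).sub
      (.mul (.mul (.mul (.const 2) hS.u_reg.bddCont_dy) hS.u_reg.bddCont_dz) hS.bddCont_N12sq)
  have := ((((hT.pow 2).add (.mul (.const (4 * S.Jm R)) hX)).comp Real.continuous_sqrt).sub hT).mul
    (.const (2 : ℝ)⁻¹)
  exact this.congr fun x _ => by rw [BaseState.misalignment, div_eq_mul_inv]

lemma bddCont_shifted (c : ℂ) : R.BddCont (shifted S c) :=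
  hS.u_reg.bddCont.ofReal.sub (.const c)

lemma bddCont_inv_sonic {c : ℂ} (hc : c.im ≠ 0) :
    R.BddCont fun x => ((S.s x : ℂ) ^ 2 - shifted S c x ^ 2)⁻¹ := by
  have h : R.BddCont fun x => (S.s x : ℂ) ^ 2 - shifted S c x ^ 2 :=
    (hS.bddCont_s_sq.ofReal.sub ((hS.bddCont_shifted c).pow 2)).congr fun x _ => by push_cast; rfl
  refine h.inv (ε := c.im ^ 2) (by positivity) fun x _ => ?_
  have := im_sq_le_norm_sq_sub_sq (S.s x) (shifted S c x)
  rwa [shifted_im, neg_sq] at this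

lemma bddCont_momentum_coeff (k : ℝ) (c : ℂ) :
    R.BddCont fun x => (k : ℂ) ^ 2 * S.ρ x * (shifted S c x ^ 2 - (S.a x ^ 2 : ℝ)) :=
  .mul (.mul (.const _) hS.ρ_reg.bddCont.ofReal)
    (((hS.bddCont_shifted c).pow 2).sub hS.bddCont_a_sq.ofReal)

end BaseState.IsAdmissible

/-! ### Integrability of the mode and the weak identities. -/

lemma dy_conj {f : ℝ × ℝ → ℂ} {x : ℝ × ℝ} (hf : DifferentiableAt ℝ f x) :
    dy (fun y => conj (f y)) x = conj (dy f x) := by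
  have := ((Complex.conjCLE : ℂ →L[ℝ] ℂ).hasFDerivAt.comp x hf.hasFDerivAt).fderiv
  simpa [dy, Function.comp_def] using congrArg (fun L => L (1, 0)) this

lemma dz_conj {f : ℝ × ℝ → ℂ} {x : ℝ × ℝ} (hf : DifferentiableAt ℝ f x) :
    dz (fun y => conj (f y)) x = conj (dz f x) := by
  have := ((Complex.conjCLE : ℂ →L[ℝ] ℂ).hasFDerivAt.comp x hf.hasFDerivAt).fderiv
  simpa [dz, Function.comp_def] using congrArg (fun L => L (0, 1)) this

/-- The shear term `ξ · ∇u`. -/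
def Perturbation.h (w : Perturbation) (S : BaseState) (k : ℝ) (c : ℂ) (x : ℝ × ℝ) : ℂ :=
  dy S.u x * w.η S k c x + dz S.u x * w.ζ S k c x

namespace IsNormalMode

variable {R : CrossSection} {S : BaseState} {k : ℝ} {c : ℂ} {w : Perturbation}
  (hw : IsNormalMode R S k c w) (hS : S.IsAdmissible R) (hk : k ≠ 0) (hc : c.im ≠ 0)
include hw hS

lemma memLp_h : MemLp (w.h S k c) 2 R.cellMeasure :=
  (hS.u_reg.bddCont_dy.ofReal.mul_memLp hw.memLp_η).add
    (hS.u_reg.bddCont_dz.ofReal.mul_memLp hw.memLp_ζ)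

include hc in
lemma memLp_P : MemLp (w.P S k c) 2 R.cellMeasure := by
  have h1 := hS.bddCont_s_sq.ofReal.mul_memLp hw.memLp_div
  have h2 := (hS.bddCont_dyG.ofReal.mul_memLp hw.memLp_η).add
    (hS.bddCont_dzG.ofReal.mul_memLp hw.memLp_ζ)
  refine ((hS.bddCont_inv_sonic hc).mul_memLp (h1.add h2)).ae_eq (ae_of_all _ fun x => ?_)
  simp only [Perturbation.P, Perturbation.δ, Pi.add_apply, div_eq_mul_inv]
  push_cast
  ring

include hk hc

lemma memLp_q : MemLp w.q 2 R.cellMeasure := by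
  have h1 := ((hS.bddCont_shifted c).pow 2).mul_memLp (hw.memLp_P hS hc)
  have h2 := hS.bddCont_a_sq.ofReal.mul_memLp hw.memLp_div
  refine (hS.ρ_reg.bddCont.ofReal.mul_memLp (h1.sub h2)).ae_eq ?_
  filter_upwards [R.ae_mem_D] with x hx
  rw [(hw.amplitudes hS hk hc hx).2.2.1]
  rfl

lemma memLp_ρ : MemLp w.ρ 2 R.cellMeasure := by
  have h1 := hS.ρ_reg.bddCont.ofReal.mul_memLp ((hw.memLp_P hS hc).sub hw.memLp_div)
  have h2 := (hS.ρ_reg.bddCont_dy.ofReal.mul_memLp hw.memLp_η).add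
    (hS.ρ_reg.bddCont_dz.ofReal.mul_memLp hw.memLp_ζ)
  refine (h1.sub h2).ae_eq ?_
  filter_upwards [R.ae_mem_D] with x hx
  rw [(hw.amplitudes hS hk hc hx).2.2.2]
  simp only [Perturbation.δ, Pi.sub_apply, Pi.add_apply]
  ring

/-- Nothing is assumed about derivatives of the pressure: the momentum equation expresses them by ξ
and the density amplitude, which are already square integrable. -/
lemma memLp_dy_q : MemLp (dy w.q) 2 R.cellMeasure := by
  refine (((hS.bddCont_momentum_coeff k c).mul_memLp hw.memLp_η).add
    (hS.bddCont_dyG.ofReal.mul_memLp (hw.memLp_ρ hS hk hc))).ae_eq ?_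
  filter_upwards [R.ae_mem_D] with x hx
  rw [(hw.grad_q hS hk hc hx).1]
  rfl

lemma memLp_dz_q : MemLp (dz w.q) 2 R.cellMeasure := by
  refine (((hS.bddCont_momentum_coeff k c).mul_memLp hw.memLp_ζ).add
    (hS.bddCont_dzG.ofReal.mul_memLp (hw.memLp_ρ hS hk hc))).ae_eq ?_
  filter_upwards [R.ae_mem_D] with x hx
  rw [(hw.grad_q hS hk hc hx).2]
  rfl

omit hk hc in
lemma dy_weighted_q {φ : ℝ → ℂ} (hφ : ContDiff ℝ 1 φ) {x : ℝ × ℝ} (hx : x ∈ R.D) :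
    dy (fun y => conj (φ (S.u y) * w.q y)) x
      = conj (deriv φ (S.u x) * dy S.u x * w.q x + φ (S.u x) * dy w.q x) := by
  have du := hS.u_reg.differentiableAt hx
  have dφ := (hφ.differentiable one_ne_zero (S.u x)).hasDerivAt
  have dφu : DifferentiableAt ℝ (fun y => φ (S.u y)) x := dφ.differentiableAt.comp x du
  have dq := (hw.q_reg.differentiableOn one_ne_zero).differentiableAt (R.isOpen_D.mem_nhds hx)
  rw [dy_conj (dφu.fun_mul dq), dy_mul dφu dq, dy, fderiv_comp_real_apply dφ du]
  rfl

omit hk hc in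
lemma dz_weighted_q {φ : ℝ → ℂ} (hφ : ContDiff ℝ 1 φ) {x : ℝ × ℝ} (hx : x ∈ R.D) :
    dz (fun y => conj (φ (S.u y) * w.q y)) x
      = conj (deriv φ (S.u x) * dz S.u x * w.q x + φ (S.u x) * dz w.q x) := by
  have du := hS.u_reg.differentiableAt hx
  have dφ := (hφ.differentiable one_ne_zero (S.u x)).hasDerivAt
  have dφu : DifferentiableAt ℝ (fun y => φ (S.u y)) x := dφ.differentiableAt.comp x du
  have dq := (hw.q_reg.differentiableOn one_ne_zero).differentiableAt (R.isOpen_D.mem_nhds hx)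
  rw [dz_conj (dφu.fun_mul dq), dz_mul dφu dq, dz, fderiv_comp_real_apply dφ du]
  rfl

/-- The free-surface condition on the pressure is exactly what the class of test functions demands,
and a bounded weight preserves it. -/
lemma isTest_weighted_q {φ : ℝ → ℂ} (hφ : ContDiff ℝ 1 φ) :
    R.IsTest fun x => conj (φ (S.u x) * w.q x) := by
  have hb : R.BddCont fun x => φ (S.u x) := hS.u_reg.bddCont.comp hφ.continuous
  have hb' : R.BddCont fun x => deriv φ (S.u x) :=
    hS.u_reg.bddCont.comp (hφ.continuous_deriv le_rfl)
  have hq := hw.memLp_q hS hk hc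
  refine ⟨?_, ?_, memLp_conj (hb.mul_memLp hq), ?_, ?_, ?_⟩
  · exact Complex.conjCLE.contDiff.comp_contDiffOn ((hφ.comp_contDiffOn hS.u_reg.1).mul hw.q_reg)
  · intro l hl x hx
    have := hw.periodic l hl x hx
    simp only [Prod.mk.injEq] at this
    simp only [hS.u_periodic l hl x hx, this.2.2.2.2.2.2.2]
  · refine (memLp_conj (((hb'.mul hS.u_reg.bddCont_dy.ofReal).mul_memLp hq).add
      (hb.mul_memLp (hw.memLp_dy_q hS hk hc)))).ae_eq ?_
    filter_upwards [R.ae_mem_D] with x hx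
    rw [hw.dy_weighted_q hS hφ hx]
    rfl
  · refine (memLp_conj (((hb'.mul hS.u_reg.bddCont_dz.ofReal).mul_memLp hq).add
      (hb.mul_memLp (hw.memLp_dz_q hS hk hc)))).ae_eq ?_
    filter_upwards [R.ae_mem_D] with x hx
    rw [hw.dz_weighted_q hS hφ hx]
    rfl
  · intro x hx
    obtain ⟨C, hC⟩ := hb.2
    have h0 : Tendsto (fun y => C * ‖w.q y‖) (𝓝[R.D] x) (𝓝 0) := by
      simpa using (hw.free_surface x hx).norm.const_mul C
    refine squeeze_zero_norm' ?_ h0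
    filter_upwards [self_mem_nhdsWithin] with y hy
    rw [RCLike.norm_conj, norm_mul]
    gcongr
    exact hC y hy

/-- The momentum balance tested with `φ(u)` times the conjugate displacement. -/
lemma weighted_identity {φ : ℝ → ℂ} (hφ : ContDiff ℝ 1 φ) :
    Integrable (fun x => φ (S.u x) * (w.q x * conj (w.δ S k c x)
        + (dy w.q x * conj (w.η S k c x) + dz w.q x * conj (w.ζ S k c x)))
      + deriv φ (S.u x) * w.q x * conj (w.h S k c x)) R.cellMeasure ∧
    ∫ x, φ (S.u x) * (w.q x * conj (w.δ S k c x)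
        + (dy w.q x * conj (w.η S k c x) + dz w.q x * conj (w.ζ S k c x)))
      + deriv φ (S.u x) * w.q x * conj (w.h S k c x) ∂(R.cellMeasure) = 0 := by
  -- The weak boundary condition already is the integration by parts. Differentiating the weight
  -- φ(u) produces the shear term φ'(u) q̃ h̄.
  have ht := hw.isTest_weighted_q hS hk hc hφ
  have hae : (fun x => conj (conj (φ (S.u x) * w.q x)
        * (dy (w.η S k c) x + dz (w.ζ S k c) x)
      + (dy (fun y => conj (φ (S.u y) * w.q y)) x * w.η S k c x
        + dz (fun y => conj (φ (S.u y) * w.q y)) x * w.ζ S k c x))) =ᵐ[R.cellMeasure]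
      fun x => φ (S.u x) * (w.q x * conj (w.δ S k c x)
        + (dy w.q x * conj (w.η S k c x) + dz w.q x * conj (w.ζ S k c x)))
      + deriv φ (S.u x) * w.q x * conj (w.h S k c x) := by
    filter_upwards [R.ae_mem_D] with x hx
    rw [hw.dy_weighted_q hS hφ hx, hw.dz_weighted_q hS hφ hx]
    simp only [map_add, map_mul, conj_conj, Perturbation.δ, Perturbation.h, conj_ofReal]
    ring
  constructor
  · refine Integrable.congr ?_ hae
    have h := (integrable_mul_of_memLp ht.memLp hw.memLp_div).add
      ((integrable_mul_of_memLp ht.memLp_dy hw.memLp_η).add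
        (integrable_mul_of_memLp ht.memLp_dz hw.memLp_ζ))
    exact (Complex.conjCLE : ℂ →L[ℝ] ℂ).integrable_comp h
  · rw [← integral_congr_ae hae, integral_conj, hw.impermeable _ ht, map_zero]

end IsNormalMode

/-! ### Nontriviality of the displacement. -/

/-- A normal mode has a displacement that does not vanish almost everywhere. -/
lemma IsNormalMode.displacement_ne_zero {R : CrossSection} {S : BaseState} {k : ℝ} {c : ℂ}
    {w : Perturbation} (hw : IsNormalMode R S k c w) (hS : S.IsAdmissible R) (hk : k ≠ 0)
    (hc : c.im ≠ 0) :
    ¬ ∀ᵐ x ∂(R.cellMeasure), w.η S k c x = 0 ∧ w.ζ S k c x = 0 := by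
  intro h
  set Z : Set (ℝ × ℝ) := {x | ¬ (w.η S k c x = 0 ∧ w.ζ S k c x = 0)} with hZ
  have hZ0 : volume (Z ∩ R.cell) = 0 :=
    le_antisymm ((Measure.le_restrict_apply _ _).trans (ae_iff.1 h).le) zero_le
  have := R.discrete_periods
  have hcount : Countable R.periods := countable_of_Lindelof_of_discrete
  have hper : ∀ l ∈ R.periods, ∀ x ∈ R.D,
      w.η S k c (x + l) = w.η S k c x ∧ w.ζ S k c (x + l) = w.ζ S k c x := by
    intro l hl x hx
    have := hw.periodic l hl x hx
    simp only [Prod.mk.injEq] at this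
    simp only [Perturbation.η, Perturbation.ζ, shifted, hS.u_periodic l hl x hx, this.2.1,
      this.2.2.1, and_self]
  -- Countably many translates of a null set are null, and by periodicity they catch every zero-free
  -- point of almost all of D.
  have hU0 : volume (⋃ g : R.periods, (fun x => (g : ℝ × ℝ) + x) ⁻¹' (Z ∩ R.cell)) = 0 :=
    measure_iUnion_null fun g => by rw [measure_preimage_add]; exact hZ0
  have hae : ∀ᵐ x ∂(volume.restrict R.D), w.η S k c x = 0 ∧ w.ζ S k c x = 0 := by
    have h1 : ∀ᵐ x ∂(volume.restrict R.D),
        x ∉ ⋃ g : R.periods, (fun x => (g : ℝ × ℝ) + x) ⁻¹' (Z ∩ R.cell) :=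
      ae_restrict_of_ae (measure_eq_zero_iff_ae_notMem.1 hU0)
    filter_upwards [h1, R.isFundamentalDomain.ae_covers,
      ae_restrict_mem R.isOpen_D.measurableSet] with x hx1 ⟨g, hg⟩ hxD
    by_contra hne
    refine hx1 (mem_iUnion.2 ⟨g, ?_, hg⟩)
    have := hper g g.2 x hxD
    rw [add_comm] at this
    simpa only [hZ, mem_ofPred_eq, this.1, this.2] using hne
  have hη : EqOn (w.η S k c) (fun _ => 0) R.D :=
    Measure.eqOn_open_of_ae_eq (hae.mono fun _ hx => hx.1) R.isOpen_D
      (hw.contDiffOn_η hS hk hc).continuousOn continuousOn_const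
  have hζ : EqOn (w.ζ S k c) (fun _ => 0) R.D :=
    Measure.eqOn_open_of_ae_eq (hae.mono fun _ hx => hx.2) R.isOpen_D
      (hw.contDiffOn_ζ hS hk hc).continuousOn continuousOn_const
  obtain ⟨x, hx, hne⟩ := hw.nontrivial
  -- Continuity has made ξ vanish on all of the open set D, so its derivatives vanish too, and with
  -- them every amplitude.
  have hδ : w.δ S k c x = 0 := by
    have h1 := (hη.eventuallyEq_of_mem (R.isOpen_D.mem_nhds hx)).fderiv_eq (𝕜 := ℝ)
    have h2 := (hζ.eventuallyEq_of_mem (R.isOpen_D.mem_nhds hx)).fderiv_eq (𝕜 := ℝ)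
    simp [Perturbation.δ, dy, dz, h1, h2]
  have hηx : w.η S k c x = 0 := hη hx
  have hζx : w.ζ S k c x = 0 := hζ hx
  have hP : w.P S k c x = 0 := by simp [Perturbation.P, hδ, hηx, hζx]
  obtain ⟨e1, e2, e3, e4⟩ := hw.amplitudes hS hk hc hx
  apply hne
  rw [e1, e2, e3, e4, hw.bY_eq hk hc hx, hw.bz_eq hk hc hx, Perturbation.vy_eq S hk hc,
    Perturbation.vz_eq S hk hc, hδ, hηx, hζx, hP]
  simp

/-! ### The phase weight and its cross terms. -/

/-- The modulus of `t - c`. -/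
def modulus (c : ℂ) (t : ℝ) : ℝ := Real.sqrt ((t - c.re) ^ 2 + c.im ^ 2)

/-- The phase factor `|t - c| / (t - c)`. -/
def phase (c : ℂ) (t : ℝ) : ℂ := ((t : ℂ) - conj c) * ((modulus c t)⁻¹ : ℝ)

lemma modulus_sq (c : ℂ) (t : ℝ) : modulus c t ^ 2 = (t - c.re) ^ 2 + c.im ^ 2 :=
  Real.sq_sqrt (by positivity)

lemma abs_im_le_modulus (c : ℂ) (t : ℝ) : |c.im| ≤ modulus c t :=
  Real.abs_le_sqrt (by nlinarith [sq_nonneg (t - c.re)])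

lemma modulus_pos {c : ℂ} (hc : c.im ≠ 0) (t : ℝ) : 0 < modulus c t :=
  (abs_pos.2 hc).trans_le (abs_im_le_modulus c t)

lemma continuous_modulus (c : ℂ) : Continuous (modulus c) := by
  unfold modulus
  fun_prop

lemma contDiff_phase {c : ℂ} (hc : c.im ≠ 0) : ContDiff ℝ 1 (phase c) := by
  have h1 : ContDiff ℝ 1 (fun t : ℝ => (t : ℂ) - conj c) :=
    Complex.ofRealCLM.contDiff.sub contDiff_const
  have h2 : ContDiff ℝ 1 (modulus c) := by
    refine ContDiff.sqrt (by fun_prop) fun t => ?_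
    have : 0 < c.im ^ 2 := by positivity
    nlinarith [sq_nonneg (t - c.re)]
  exact h1.mul (Complex.ofRealCLM.contDiff.comp (h2.inv fun t => (modulus_pos hc t).ne'))

/-- The weight has modulus one, so its logarithmic derivative is purely imaginary: (t - c_r)/|t -
c|² - 1/(t - c) = -i c_i/|t - c|². The factor c_i can later be divided out of the whole balance. -/
lemma deriv_phase {c : ℂ} (hc : c.im ≠ 0) (t : ℝ) :
    deriv (phase c) t = -(I * c.im) * phase c t / (modulus c t : ℂ) ^ 2 := by
  have hV := modulus_pos hc t
  have hV' : (modulus c t : ℂ) ≠ 0 := by exact_mod_cast hV.ne'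
  have hpos : (t - c.re) ^ 2 + c.im ^ 2 ≠ 0 := by rw [← modulus_sq]; positivity
  have h0 : HasDerivAt (fun t : ℝ => (t - c.re) ^ 2 + c.im ^ 2) (2 * (t - c.re)) t := by
    simpa using (((hasDerivAt_id t).sub_const c.re).pow 2).add_const (c.im ^ 2)
  have h1 : HasDerivAt (modulus c) ((2 * (t - c.re)) / (2 * modulus c t)) t := h0.sqrt hpos
  have h2 := (hasDerivAt_sub_const_ofReal (conj c) t).mul (h1.inv hV.ne').ofReal_comp
  have h3 : deriv (phase c) t = _ := h2.deriv
  rw [h3, phase, Pi.inv_apply]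
  have hsq : (modulus c t : ℂ) ^ 2 = (t - conj c) * (t - c) := by
    have h4 : (modulus c t : ℂ) ^ 2 = ((t - c.re) ^ 2 + c.im ^ 2 : ℝ) := by
      rw [← modulus_sq]; push_cast; rfl
    rw [h4]
    apply Complex.ext
    · simp [sq]
    · simp [sq]
      ring
  have hc' : c = c.re + c.im * I := (Complex.re_add_im c).symm
  have h5 : (c.re : ℂ) = c - c.im * I := by linear_combination -hc'
  push_cast
  rw [h5]
  field_simp
  linear_combination hsq

/-- The imaginary part of the energy density weighted by the phase of the shifted velocity. -/
lemma im_phase_weighted {U X Y : ℂ} {ci V ρ A K a2 : ℝ} (hV : 0 < V) (hU : U.im = -ci)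
    (hVU : V ^ 2 = normSq U) :
    (conj U * (V⁻¹ : ℝ) * (ρ * (U ^ 2 * A - K))
      + -(I * ci) * (conj U * (V⁻¹ : ℝ)) / (V : ℂ) ^ 2 * (ρ * (U ^ 2 * X - a2 * Y))).im
    = -ci * (ρ * (V * A + K / V + (U * X).re / V - a2 * (conj U * Y).re / V ^ 3)) := by
  have hV' : (V : ℂ) ≠ 0 := by exact_mod_cast hV.ne'
  have h1 : conj U * U = (V : ℂ) ^ 2 := by
    rw [mul_comm, Complex.mul_conj, ← hVU]; push_cast; rfl
  -- The weight turns U²A - K into V A U - K Ū/V. Conjugation reverses the sign of the imaginary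
  -- part, so both energies contribute with the same sign.
  have h2 : conj U * (V⁻¹ : ℝ) * (ρ * (U ^ 2 * A - K))
      + -(I * ci) * (conj U * (V⁻¹ : ℝ)) / (V : ℂ) ^ 2 * (ρ * (U ^ 2 * X - a2 * Y))
      = (ρ * V * A : ℝ) * U - (ρ * K / V : ℝ) * conj U
        + (-(ρ * ci / V) : ℝ) * (I * (U * X)) + (ρ * ci * a2 / V ^ 3 : ℝ) * (I * (conj U * Y)) := by
    push_cast
    field_simp
    linear_combination ρ * (V ^ 2 * A * U - I * ci * U * X) * h1
  rw [h2]
  simp only [add_im, sub_im, im_ofReal_mul, I_mul_im, conj_im, hU]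
  field_simp
  ring

/-- Completing the squares in the cross terms of the weighted energy density. -/
lemma cross_terms_ge {U P δ h : ℂ} {V a2 aM ci t : ℝ} (hV : 0 < V) (hVU : V ^ 2 = normSq U)
    (hci : ci ≠ 0) (hciV : ci ^ 2 ≤ V ^ 2) (ha : 0 ≤ a2) (haM : a2 ≤ aM) (ht : 0 < t) :
    -((t * (V * normSq P) + normSq h / V / t) / 2 + aM / ci ^ 2 / 4 * (normSq h / V))
      ≤ a2 * normSq δ / V + (U * (P * conj h)).re / V - a2 * (conj U * (δ * conj h)).re / V ^ 3 := by
  have hn : ‖U‖ = V := by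
    rw [← Real.sqrt_sq (norm_nonneg U), ← Complex.normSq_eq_norm_sq, ← hVU, Real.sqrt_sq hV.le]
  have h1 : -(V * (‖P‖ * ‖h‖)) ≤ (U * (P * conj h)).re := by
    have := (abs_le.1 (Complex.abs_re_le_norm (U * (P * conj h)))).1
    simpa [hn] using this
  have h2 : (conj U * (δ * conj h)).re ≤ V * (‖δ‖ * ‖h‖) := by
    have := (abs_le.1 (Complex.abs_re_le_norm (conj U * (δ * conj h)))).2
    simpa [hn] using this
  have e1 : -(‖P‖ * ‖h‖) ≤ (U * (P * conj h)).re / V := by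
    rw [le_div_iff₀ hV]; linarith
  have e2 : a2 * (conj U * (δ * conj h)).re / V ^ 3 ≤ a2 * (‖δ‖ * ‖h‖) / V ^ 2 := by
    rw [div_le_div_iff₀ (by positivity) (by positivity)]
    calc a2 * (conj U * (δ * conj h)).re * V ^ 2 ≤ a2 * (V * (‖δ‖ * ‖h‖)) * V ^ 2 := by gcongr
      _ = _ := by ring
  simp only [Complex.normSq_eq_norm_sq]
  generalize ‖P‖ = p at *
  generalize ‖h‖ = g at *
  generalize ‖δ‖ = d at *
  have e3 : p * g ≤ (t * (V * p ^ 2) + g ^ 2 / V / t) / 2 := by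
    have : (t * (V * p ^ 2) + g ^ 2 / V / t) / 2 - p * g = (t * V * p - g) ^ 2 / (2 * t * V) := by
      field_simp; ring
    have h0 : 0 ≤ (t * V * p - g) ^ 2 / (2 * t * V) := by positivity
    linarith
  -- The magnetic energy a²|δ|²/V absorbs its cross term; what is left of the square is the
  -- a_M²/c_i² contribution to the radicand.
  have e4 : a2 * (d * g) / V ^ 2 ≤ a2 * d ^ 2 / V + a2 / V ^ 2 / 4 * (g ^ 2 / V) := by
    have : a2 * d ^ 2 / V + a2 / V ^ 2 / 4 * (g ^ 2 / V) - a2 * (d * g) / V ^ 2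
        = a2 * (2 * V * d - g) ^ 2 / (4 * V ^ 3) := by
      field_simp; ring
    have h0 : 0 ≤ a2 * (2 * V * d - g) ^ 2 / (4 * V ^ 3) := by positivity
    linarith
  have e5 : a2 / V ^ 2 / 4 * (g ^ 2 / V) ≤ aM / ci ^ 2 / 4 * (g ^ 2 / V) := by
    have : 0 < ci ^ 2 := by positivity
    have : 0 ≤ aM := ha.trans haM
    gcongr
  linarith

/-! ### Bounds for the base state and the buoyancy form. -/

namespace BaseState.IsAdmissible

variable {R : CrossSection} {S : BaseState} (hS : S.IsAdmissible R)
include hS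

/-- The buoyancy matrix is ∇G ⊗ (∇ρ/ρ - ∇G/s²), of rank at most one, and parallel gradients make it
symmetric. -/
lemma N_det {x : ℝ × ℝ} (hx : x ∈ R.D) : S.N1sq x * S.N2sq x = S.N12sq x ^ 2 := by
  have hρ := (hS.ρ_pos' hx).ne'
  have hs := (hS.s_sq_pos hx).ne'
  have hp := hS.parallel hx
  have h1 : S.N12sq x = dy S.G x * dz S.ρ x / S.ρ x - dy S.G x * dz S.G x / S.s x ^ 2 := by
    rw [BaseState.N12sq, hp]
  rw [sq]
  nth_rewrite 1 [h1]
  simp only [BaseState.N1sq, BaseState.N2sq, BaseState.N12sq]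
  ring

omit hS in
lemma _root_.MagnetoShear.BaseState.Jm_nonneg (hN : ∀ x ∈ R.D, 0 ≤ S.N1sq x + S.N2sq x) :
    0 ≤ S.Jm R := by
  apply Real.sInf_nonneg
  rintro _ ⟨x, hx, rfl⟩
  exact div_nonneg (hN x hx.1) (add_nonneg (sq_nonneg _) (sq_nonneg _))

/-- Determinant zero forbids diagonal entries of opposite sign, so nonnegative trace makes the
buoyancy matrix positive semidefinite. -/
lemma N_nonneg (hN : ∀ x ∈ R.D, 0 ≤ S.N1sq x + S.N2sq x) {x : ℝ × ℝ} (hx : x ∈ R.D) :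
    0 ≤ S.N1sq x ∧ 0 ≤ S.N2sq x := by
  have h1 := hN x hx
  have h2 := hS.N_det hx
  constructor <;> by_contra! h <;> nlinarith [sq_nonneg (S.N12sq x)]

/-- The term added to T² under the root is 4J_m times the buoyancy form at (u_z, -u_y), the
direction orthogonal to ∇u; hence the root is at least T. -/
lemma misalignment_nonneg (hN : ∀ x ∈ R.D, 0 ≤ S.N1sq x + S.N2sq x) {x : ℝ × ℝ} (hx : x ∈ R.D) :
    0 ≤ S.misalignment R x := by
  obtain ⟨h1, h2⟩ := hS.N_nonneg hN hx
  have h3 := hermitian_form_nonneg h1 h2 (hS.N_det hx).ge (dz S.u x : ℝ) (-dy S.u x : ℝ)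
  have h4 : 0 ≤ dz S.u x ^ 2 * S.N1sq x + dy S.u x ^ 2 * S.N2sq x
      - 2 * dy S.u x * dz S.u x * S.N12sq x := by
    simp [Complex.normSq_apply] at h3
    nlinarith
  have h5 := mul_nonneg (mul_nonneg zero_le_four (S.Jm_nonneg hN)) h4
  have h6 := Real.le_sqrt_of_sq_le (le_add_of_nonneg_right (a :=
    (S.N1sq x + S.N2sq x - S.Jm R * S.shearSq x) ^ 2) h5)
  rw [BaseState.misalignment]
  linarith

lemma misalignment_le {x : ℝ × ℝ} (hx : x ∈ R.D) : S.misalignment R x ≤ S.lamM R := by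
  obtain ⟨C, hC⟩ := hS.bddCont_misalignment.2
  refine le_csSup ⟨C, ?_⟩ ⟨x, hx, rfl⟩
  rintro _ ⟨y, hy, rfl⟩
  exact (le_abs_self _).trans (hC y hy)

lemma a_sq_le {x : ℝ × ℝ} (hx : x ∈ R.D) : S.a x ^ 2 ≤ S.aMsq R := by
  obtain ⟨C, hC⟩ := hS.bddCont_a_sq.2
  refine le_csSup ⟨C, ?_⟩ ⟨x, hx, rfl⟩
  rintro _ ⟨y, hy, rfl⟩
  exact (le_abs_self _).trans (hC y hy)

/-- The base velocity lies between its extrema. -/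
lemma u_sub_uPlus_sq_le {x : ℝ × ℝ} (hx : x ∈ R.D) :
    (S.u x - S.uPlus R) ^ 2 ≤ S.uMinus R ^ 2 := by
  obtain ⟨C, hC⟩ := hS.u_reg.bddCont.2
  have h1 : S.u x ≤ sSup (S.u '' R.D) := by
    refine le_csSup ⟨C, ?_⟩ ⟨x, hx, rfl⟩
    rintro _ ⟨y, hy, rfl⟩
    exact (abs_le.1 (hC y hy)).2
  have h2 : sInf (S.u '' R.D) ≤ S.u x := by
    refine csInf_le ⟨-C, ?_⟩ ⟨x, hx, rfl⟩
    rintro _ ⟨y, hy, rfl⟩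
    exact (abs_le.1 (hC y hy)).1
  rw [BaseState.uPlus, BaseState.uMinus]
  nlinarith [mul_nonneg (sub_nonneg.2 h1) (sub_nonneg.2 h2)]

omit hS in
lemma _root_.MagnetoShear.BaseState.Θ_le (c : ℂ) {x : ℝ × ℝ} (hx : x ∈ R.D) :
    S.Θ R c ≤ min (S.a x ^ 2) (c.im ^ 4 / S.s x ^ 2) := by
  refine csInf_le ⟨0, ?_⟩ ⟨x, hx, rfl⟩
  rintro _ ⟨y, hy, rfl⟩
  exact le_min (sq_nonneg _) (by positivity)

end BaseState.IsAdmissible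

/-- The buoyancy energy density (per unit mass) of the displacement. -/
def Perturbation.buoyancy (w : Perturbation) (S : BaseState) (k : ℝ) (c : ℂ) (x : ℝ × ℝ) : ℝ :=
  S.N1sq x * normSq (w.η S k c x) + S.N2sq x * normSq (w.ζ S k c x)
    + 2 * S.N12sq x * (w.η S k c x * conj (w.ζ S k c x)).re

/-- The squared modulus of the displacement. -/
def Perturbation.ξsq (w : Perturbation) (S : BaseState) (k : ℝ) (c : ℂ) (x : ℝ × ℝ) : ℝ :=
  normSq (w.η S k c x) + normSq (w.ζ S k c x)

section Buoyancy

variable {R : CrossSection} {S : BaseState} (w : Perturbation) (k : ℝ) (c : ℂ)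

lemma buoyancy_nonneg (hS : S.IsAdmissible R) (hN : ∀ x ∈ R.D, 0 ≤ S.N1sq x + S.N2sq x)
    {x : ℝ × ℝ} (hx : x ∈ R.D) : 0 ≤ w.buoyancy S k c x := by
  obtain ⟨h1, h2⟩ := hS.N_nonneg hN hx
  exact hermitian_form_nonneg h1 h2 (hS.N_det hx).ge _ _

lemma Perturbation.ξsq_nonneg (S : BaseState) (x : ℝ × ℝ) : 0 ≤ w.ξsq S k c x :=
  add_nonneg (normSq_nonneg _) (normSq_nonneg _)

/-- Buoyancy dominates shear up to the misalignment. -/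
lemma le_buoyancy (hS : S.IsAdmissible R) {x : ℝ × ℝ} (hx : x ∈ R.D) :
    S.Jm R * normSq (w.h S k c x)
      ≤ w.buoyancy S k c x + S.lamM R * w.ξsq S k c x := by
  -- The misalignment is minus the lowest eigenvalue of the buoyancy matrix less J_m ∇u ⊗ ∇u;
  -- `N_det` brings its discriminant to the stated form. This is linear algebra in which J_m could
  -- be any real number.
  have h1 := hermitian_form_ge (m₁ := S.N1sq x - S.Jm R * dy S.u x ^ 2)
    (m₂ := S.N2sq x - S.Jm R * dz S.u x ^ 2)
    (m₁₂ := S.N12sq x - S.Jm R * (dy S.u x * dz S.u x)) rfl (w.η S k c x) (w.ζ S k c x)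
  have h2 : S.misalignment R x = (Real.sqrt ((S.N1sq x - S.Jm R * dy S.u x ^ 2
        + (S.N2sq x - S.Jm R * dz S.u x ^ 2)) ^ 2
        - 4 * ((S.N1sq x - S.Jm R * dy S.u x ^ 2) * (S.N2sq x - S.Jm R * dz S.u x ^ 2)
          - (S.N12sq x - S.Jm R * (dy S.u x * dz S.u x)) ^ 2))
      - (S.N1sq x - S.Jm R * dy S.u x ^ 2 + (S.N2sq x - S.Jm R * dz S.u x ^ 2))) / 2 := by
    rw [BaseState.misalignment, BaseState.shearSq]
    congr 2
    · congr 1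
      linear_combination 4 * hS.N_det hx
    · ring
  rw [← h2] at h1
  have h3 := mul_le_mul_of_nonneg_right (hS.misalignment_le hx) (w.ξsq_nonneg k c S x)
  have h4 : normSq (w.h S k c x) = dy S.u x ^ 2 * normSq (w.η S k c x)
      + dz S.u x ^ 2 * normSq (w.ζ S k c x)
      + 2 * (dy S.u x * dz S.u x) * (w.η S k c x * conj (w.ζ S k c x)).re := by
    simp [Perturbation.h, Complex.normSq_apply]
    ring
  rw [h4]
  simp only [Perturbation.buoyancy, Perturbation.ξsq] at *
  linarith

end Buoyancy

/-! ### Energy balances and the semicircle inequality. -/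

/-- The wave energy density (per unit mass) that multiplies `U²` in the energy balance. -/
def Perturbation.kinetic (w : Perturbation) (S : BaseState) (k : ℝ) (c : ℂ) (x : ℝ × ℝ) : ℝ :=
  k ^ 2 * w.ξsq S k c x + normSq (w.P S k c x)

/-- The magnetic, acoustic and buoyancy energy density (per unit mass). -/
def Perturbation.potential (w : Perturbation) (S : BaseState) (k : ℝ) (c : ℂ) (x : ℝ × ℝ) : ℝ :=
  k ^ 2 * S.a x ^ 2 * w.ξsq S k c x + normSq (shifted S c x) ^ 2 / S.s x ^ 2 * normSq (w.P S k c x)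
    + S.a x ^ 2 * normSq (w.δ S k c x) + w.buoyancy S k c x

lemma normSq_shifted (S : BaseState) (c : ℂ) (x : ℝ × ℝ) :
    modulus c (S.u x) ^ 2 = normSq (shifted S c x) := by
  rw [modulus_sq, Complex.normSq_apply, shifted_re, shifted_im]
  ring

lemma Perturbation.kinetic_nonneg (w : Perturbation) (S : BaseState) (k : ℝ) (c : ℂ)
    (x : ℝ × ℝ) : 0 ≤ w.kinetic S k c x :=
  add_nonneg (mul_nonneg (sq_nonneg k) (w.ξsq_nonneg k c S x)) (normSq_nonneg _)

/-- Θ ≤ a² serves the part k²|ξ|² of the wave energy, and Θ ≤ c_i⁴/s² ≤ |U|⁴/s² the part |P|²; the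
energy a²|δ|² is discarded. -/
lemma potential_ge {R : CrossSection} {S : BaseState} (w : Perturbation) (k : ℝ) (c : ℂ)
    {x : ℝ × ℝ} (hx : x ∈ R.D) :
    S.Θ R c * w.kinetic S k c x + w.buoyancy S k c x ≤ w.potential S k c x := by
  have h := S.Θ_le c hx
  have h1 : S.Θ R c ≤ S.a x ^ 2 := h.trans (min_le_left _ _)
  have h2 : S.Θ R c ≤ normSq (shifted S c x) ^ 2 / S.s x ^ 2 := by
    refine (h.trans (min_le_right _ _)).trans ?_
    have : c.im ^ 2 ≤ normSq (shifted S c x) := by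
      rw [← normSq_shifted, modulus_sq]
      nlinarith [sq_nonneg (S.u x - c.re)]
    calc c.im ^ 4 / S.s x ^ 2 = (c.im ^ 2) ^ 2 / S.s x ^ 2 := by ring
      _ ≤ _ := by gcongr
  have h3 := mul_le_mul_of_nonneg_right h1 (mul_nonneg (sq_nonneg k) (w.ξsq_nonneg k c S x))
  have h4 := mul_le_mul_of_nonneg_right h2 (normSq_nonneg (w.P S k c x))
  have h5 := mul_nonneg (sq_nonneg (S.a x)) (normSq_nonneg (w.δ S k c x))
  rw [Perturbation.kinetic, Perturbation.potential]
  linarith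

namespace IsNormalMode

variable {R : CrossSection} {S : BaseState} {k : ℝ} {c : ℂ} {w : Perturbation}
  (hw : IsNormalMode R S k c w) (hS : S.IsAdmissible R) (hk : k ≠ 0) (hc : c.im ≠ 0)
include hw hS

omit hS in
lemma integrable_ξsq : Integrable (w.ξsq S k c) R.cellMeasure :=
  (integrable_normSq hw.memLp_η).add (integrable_normSq hw.memLp_ζ)

lemma integrable_buoyancy : Integrable (w.buoyancy S k c) R.cellMeasure := by
  have h := (integrable_mul_of_memLp hw.memLp_η (memLp_conj hw.memLp_ζ)).re
  exact ((hS.bddCont_N1sq.mul_integrable (integrable_normSq hw.memLp_η)).add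
    (hS.bddCont_N2sq.mul_integrable (integrable_normSq hw.memLp_ζ))).add
    ((CrossSection.BddCont.mul (.const 2) hS.bddCont_N12sq).mul_integrable h)

include hc in
lemma integrable_kinetic : Integrable (w.kinetic S k c) R.cellMeasure :=
  (hw.integrable_ξsq.const_mul (k ^ 2)).add (integrable_normSq (hw.memLp_P hS hc))

include hk hc

lemma energy_density {x : ℝ × ℝ} (hx : x ∈ R.D) :
    w.q x * conj (w.δ S k c x)
      + (dy w.q x * conj (w.η S k c x) + dz w.q x * conj (w.ζ S k c x))
    = S.ρ x * (shifted S c x ^ 2 * w.kinetic S k c x - w.potential S k c x) := by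
  have hP : (((S.s x ^ 2 : ℝ) : ℂ) - shifted S c x ^ 2) * w.P S k c x
      = (S.s x ^ 2 : ℝ) * w.δ S k c x + (dy S.G x * w.η S k c x + dz S.G x * w.ζ S k c x) := by
    push_cast
    exact mul_div_cancel₀ _ (sq_sub_shifted_sq_ne_zero S hc x)
  have h := energy_density_identity (a2 := S.a x ^ 2) (k := k) (hS.ρ_pos' hx).ne'
    (hS.s_sq_pos hx).ne' (hS.parallel hx) rfl rfl rfl hP
  rw [(hw.grad_q hS hk hc hx).1, (hw.grad_q hS hk hc hx).2, (hw.amplitudes hS hk hc hx).2.2.1,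
    (hw.amplitudes hS hk hc hx).2.2.2]
  exact h

/-- The energy balance. -/
lemma energy_balance :
    Integrable (fun x => (S.ρ x : ℂ) * (shifted S c x ^ 2 * w.kinetic S k c x
      - w.potential S k c x)) R.cellMeasure ∧
    ∫ x, (S.ρ x : ℂ) * (shifted S c x ^ 2 * w.kinetic S k c x
      - w.potential S k c x) ∂(R.cellMeasure) = 0 := by
  obtain ⟨h1, h2⟩ := hw.weighted_identity hS hk hc (φ := fun _ => 1) contDiff_const
  have hae : (fun x => (1 : ℂ) * (w.q x * conj (w.δ S k c x)
        + (dy w.q x * conj (w.η S k c x) + dz w.q x * conj (w.ζ S k c x)))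
      + deriv (fun _ : ℝ => (1 : ℂ)) (S.u x) * w.q x * conj (w.h S k c x)) =ᵐ[R.cellMeasure]
      fun x => (S.ρ x : ℂ) * (shifted S c x ^ 2 * w.kinetic S k c x - w.potential S k c x) := by
    filter_upwards [R.ae_mem_D] with x hx
    rw [hw.energy_density hS hk hc hx]
    simp
  exact ⟨h1.congr hae, (integral_congr_ae hae).symm.trans h2⟩

/-- The semicircle inequality, with the buoyancy energy retained. -/
lemma semicircle :
    ((c.re - S.uPlus R) ^ 2 + c.im ^ 2 - S.uMinus R ^ 2 + S.Θ R c)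
        * ∫ x, S.ρ x * w.kinetic S k c x ∂(R.cellMeasure)
      + ∫ x, S.ρ x * w.buoyancy S k c x ∂(R.cellMeasure) ≤ 0 := by
  obtain ⟨hi, h0⟩ := hw.energy_balance hS hk hc
  have hA := hS.ρ_reg.bddCont.mul_integrable (hw.integrable_kinetic hS hc)
  have hH := hS.ρ_reg.bddCont.mul_integrable (hw.integrable_buoyancy hS)
  have hre := integral_re hi
  have him := integral_im hi
  rw [h0] at hre him
  simp only [map_zero] at hre him
  -- This multiple of the imaginary part completes the square: the coefficient of the wave energy
  -- becomes (u - u₊)² - (c_r - u₊)² - c_i².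
  set e : ℝ := (c.re - S.uPlus R) / c.im with he
  have h1 := (hi.re.sub (hi.im.const_mul e))
  have h2 : ∫ x, (RCLike.re ((S.ρ x : ℂ) * (shifted S c x ^ 2 * w.kinetic S k c x
      - w.potential S k c x)) - e * RCLike.im ((S.ρ x : ℂ) * (shifted S c x ^ 2 * w.kinetic S k c x
      - w.potential S k c x))) ∂(R.cellMeasure) = 0 := by
    rw [integral_sub hi.re (hi.im.const_mul e), integral_const_mul, hre, him]
    simp
  rw [← integral_const_mul, ← integral_add (hA.const_mul _) hH, ← neg_nonneg, ← h2, ← integral_neg]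
  refine integral_mono_ae h1 ((hA.const_mul _).add hH).neg ?_
  filter_upwards [R.ae_mem_D] with x hx
  have hb := potential_ge (S := S) w k c hx
  have hu := mul_le_mul_of_nonneg_right (hS.u_sub_uPlus_sq_le hx) (w.kinetic_nonneg S k c x)
  have hρ := hS.ρ_pos' hx
  have hr : ((S.ρ x : ℂ) * (shifted S c x ^ 2 * w.kinetic S k c x - w.potential S k c x)).re
      = S.ρ x * (((S.u x - c.re) ^ 2 - c.im ^ 2) * w.kinetic S k c x - w.potential S k c x) := by
    rw [re_ofReal_mul, sub_re, re_mul_ofReal, ofReal_re, sq, mul_re, shifted_re, shifted_im]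
    ring
  have hm : e * ((S.ρ x : ℂ) * (shifted S c x ^ 2 * w.kinetic S k c x - w.potential S k c x)).im
      = -(2 * (c.re - S.uPlus R) * (S.u x - c.re) * (S.ρ x * w.kinetic S k c x)) := by
    rw [im_ofReal_mul, sub_im, im_mul_ofReal, ofReal_im, sq, mul_im, shifted_re, shifted_im, he]
    field_simp
    ring
  simp only [RCLike.re_to_complex, RCLike.im_to_complex, hr, hm]
  nlinarith [mul_le_mul_of_nonneg_left hb hρ.le, mul_le_mul_of_nonneg_left hu hρ.le]

/-- The energy balance weighted by the phase of the shifted velocity. -/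
lemma phase_balance :
    Integrable (fun x => S.ρ x * (modulus c (S.u x) * w.kinetic S k c x
      + w.potential S k c x / modulus c (S.u x)
      + (shifted S c x * (w.P S k c x * conj (w.h S k c x))).re / modulus c (S.u x)
      - S.a x ^ 2 * (conj (shifted S c x) * (w.δ S k c x * conj (w.h S k c x))).re
        / modulus c (S.u x) ^ 3)) R.cellMeasure ∧
    ∫ x, S.ρ x * (modulus c (S.u x) * w.kinetic S k c x
      + w.potential S k c x / modulus c (S.u x)
      + (shifted S c x * (w.P S k c x * conj (w.h S k c x))).re / modulus c (S.u x)
      - S.a x ^ 2 * (conj (shifted S c x) * (w.δ S k c x * conj (w.h S k c x))).re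
        / modulus c (S.u x) ^ 3) ∂(R.cellMeasure) = 0 := by
  obtain ⟨h1, h2⟩ := hw.weighted_identity hS hk hc (contDiff_phase hc)
  have hae : (fun x => RCLike.im (phase c (S.u x) * (w.q x * conj (w.δ S k c x)
        + (dy w.q x * conj (w.η S k c x) + dz w.q x * conj (w.ζ S k c x)))
      + deriv (phase c) (S.u x) * w.q x * conj (w.h S k c x))) =ᵐ[R.cellMeasure]
      fun x => -c.im * (S.ρ x * (modulus c (S.u x) * w.kinetic S k c x
      + w.potential S k c x / modulus c (S.u x)
      + (shifted S c x * (w.P S k c x * conj (w.h S k c x))).re / modulus c (S.u x)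
      - S.a x ^ 2 * (conj (shifted S c x) * (w.δ S k c x * conj (w.h S k c x))).re
        / modulus c (S.u x) ^ 3)) := by
    filter_upwards [R.ae_mem_D] with x hx
    rw [hw.energy_density hS hk hc hx, deriv_phase hc, (hw.amplitudes hS hk hc hx).2.2.1,
      RCLike.im_to_complex, ← im_phase_weighted (modulus_pos hc (S.u x)) (shifted_im S c x)
      (normSq_shifted S c x)]
    have : phase c (S.u x) = conj (shifted S c x) * ((modulus c (S.u x))⁻¹ : ℝ) := by
      simp [phase, shifted]
    rw [this]
    congr 1
    ring
  have h3 := integral_im h1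
  rw [h2, integral_congr_ae hae, integral_const_mul, map_zero] at h3
  refine ⟨?_, (mul_eq_zero.1 h3).resolve_left (neg_ne_zero.2 hc)⟩
  have h4 := (h1.im.congr hae).const_mul (-c.im)⁻¹
  refine h4.congr (ae_of_all _ fun x => ?_)
  exact inv_mul_cancel_left₀ (neg_ne_zero.2 hc) _

/-! ### Lower bound of the buoyancy energy. -/

omit hw hk in
lemma _root_.MagnetoShear.bddCont_inv_modulus : R.BddCont fun x => (modulus c (S.u x))⁻¹ :=
  hS.u_reg.bddCont.comp ((continuous_modulus c).inv₀ fun t => (modulus_pos hc t).ne')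

omit hw hk in
lemma _root_.MagnetoShear.integrable_weighted {f : ℝ × ℝ → ℝ} (hf : Integrable f R.cellMeasure) :
    Integrable (fun x => S.ρ x * (modulus c (S.u x) * f x)) R.cellMeasure ∧
    Integrable (fun x => S.ρ x * (f x / modulus c (S.u x))) R.cellMeasure := by
  refine ⟨hS.ρ_reg.bddCont.mul_integrable
    ((hS.u_reg.bddCont.comp (continuous_modulus c)).mul_integrable hf), ?_⟩
  refine hS.ρ_reg.bddCont.mul_integrable
    (((bddCont_inv_modulus hS hc).mul_integrable hf).congr (ae_of_all _ fun x => ?_))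
  exact (div_eq_inv_mul _ _).symm

/-- The nontriviality of the mode enters the energy estimates here, as the strict inequality that
`energy_dichotomy` needs. -/
lemma displacement_energy_pos :
    0 < ∫ x, S.ρ x * (modulus c (S.u x) * (k ^ 2 * w.ξsq S k c x)) ∂(R.cellMeasure) := by
  have hi := (integrable_weighted hS hc (hw.integrable_ξsq.const_mul (k ^ 2))).1
  have hnn : 0 ≤ᵐ[R.cellMeasure]
      fun x => S.ρ x * (modulus c (S.u x) * (k ^ 2 * w.ξsq S k c x)) := by
    filter_upwards [R.ae_mem_D] with x hx
    exact mul_nonneg (hS.ρ_pos' hx).le (mul_nonneg (modulus_pos hc _).le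
      (mul_nonneg (sq_nonneg k) (w.ξsq_nonneg k c S x)))
  refine (integral_nonneg_of_ae hnn).lt_of_ne' fun h0 => ?_
  refine hw.displacement_ne_zero hS hk hc ?_
  filter_upwards [(integral_eq_zero_iff_of_nonneg_ae hnn hi).1 h0, R.ae_mem_D] with x hx hD
  have hρ := (hS.ρ_pos' hD).ne'
  have hV := (modulus_pos hc (S.u x)).ne'
  have h1 : w.ξsq S k c x = 0 := by simpa [hρ, hV, hk] using hx
  have h2 := normSq_nonneg (w.η S k c x)
  have h3 := normSq_nonneg (w.ζ S k c x)
  rw [Perturbation.ξsq] at h1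
  exact ⟨normSq_eq_zero.1 (by linarith), normSq_eq_zero.1 (by linarith)⟩

/-- For `μ > 0` the radicand is positive, and the buoyancy energy is bounded below. -/
lemma buoyancy_energy_ge (hN : ∀ x ∈ R.D, 0 ≤ S.N1sq x + S.N2sq x) (hμ : 0 < S.μ R k c) :
    0 < S.radicand R k c ∧
    (S.μ R k c + 4 * S.μ R k c ^ 2 * S.Jm R * ((1 + Real.sqrt (S.radicand R k c)) ^ 2)⁻¹ - 1)
        * ∫ x, S.ρ x * (modulus c (S.u x) * w.kinetic S k c x) ∂(R.cellMeasure)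
      ≤ ∫ x, S.ρ x * (w.buoyancy S k c x / modulus c (S.u x)) ∂(R.cellMeasure) := by
  have iE := (integrable_weighted hS hc (hw.integrable_ξsq.const_mul (k ^ 2))).1
  have iP := (integrable_weighted hS hc (integrable_normSq (hw.memLp_P hS hc))).1
  have iH := (integrable_weighted hS hc (hw.integrable_buoyancy hS)).2
  have ih := (integrable_weighted hS hc (integrable_normSq (hw.memLp_h hS))).2
  have hkin : ∫ x, S.ρ x * (modulus c (S.u x) * w.kinetic S k c x) ∂(R.cellMeasure)
      = ∫ x, S.ρ x * (modulus c (S.u x) * (k ^ 2 * w.ξsq S k c x)) ∂(R.cellMeasure)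
        + ∫ x, S.ρ x * (modulus c (S.u x) * normSq (w.P S k c x)) ∂(R.cellMeasure) := by
    rw [← integral_add iE iP]
    refine integral_congr_ae (ae_of_all _ fun x => ?_)
    simp only [Perturbation.kinetic]
    ring
  rw [hkin]
  refine energy_dichotomy (α := S.aMsq R / c.im ^ 2)
    (g := ∫ x, S.ρ x * (normSq (w.h S k c x) / modulus c (S.u x)) ∂(R.cellMeasure))
    hμ (S.Jm_nonneg hN) (hw.displacement_energy_pos hS hk hc) ?_ ?_ ?_ ?_
  · refine integral_nonneg_of_ae ?_
    filter_upwards [R.ae_mem_D] with x hx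
    exact mul_nonneg (hS.ρ_pos' hx).le (mul_nonneg (modulus_pos hc _).le (normSq_nonneg _))
  · refine integral_nonneg_of_ae ?_
    filter_upwards [R.ae_mem_D] with x hx
    exact mul_nonneg (hS.ρ_pos' hx).le (div_nonneg (normSq_nonneg _) (modulus_pos hc _).le)
  · rw [← integral_add iE iP, ← integral_const_mul, ← integral_const_mul,
      ← integral_add iH ((iE.fun_add iP).const_mul _)]
    refine integral_mono_ae (ih.const_mul _) (iH.add ((iE.fun_add iP).const_mul _)) ?_
    filter_upwards [R.ae_mem_D] with x hx
    have hV := modulus_pos hc (S.u x)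
    have hlam : 0 ≤ S.lamM R := (hS.misalignment_nonneg hN hx).trans (hS.misalignment_le hx)
    have h1 := div_le_div_of_nonneg_right (le_buoyancy w k c hS hx) hV.le
    have hξ := w.ξsq_nonneg k c S x
    -- Passing from the weight 1/|U| to |U| costs the factor 1/c_i², because c_i² ≤ |U|²; this
    -- produces 1 - μ = λ_M/(k²c_i²).
    have h2 : S.lamM R * w.ξsq S k c x / modulus c (S.u x)
        ≤ S.lamM R / (k ^ 2 * c.im ^ 2) * (modulus c (S.u x) * (k ^ 2 * w.ξsq S k c x)) := by
      have h3 : c.im ^ 2 ≤ modulus c (S.u x) ^ 2 := by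
        rw [modulus_sq]; nlinarith [sq_nonneg (S.u x - c.re)]
      have h4 : S.lamM R / (k ^ 2 * c.im ^ 2) * (modulus c (S.u x) * (k ^ 2 * w.ξsq S k c x))
          - S.lamM R * w.ξsq S k c x / modulus c (S.u x)
          = S.lamM R * w.ξsq S k c x * (modulus c (S.u x) ^ 2 - c.im ^ 2)
            / (c.im ^ 2 * modulus c (S.u x)) := by
        field_simp
      have h5 : 0 ≤ S.lamM R * w.ξsq S k c x * (modulus c (S.u x) ^ 2 - c.im ^ 2)
            / (c.im ^ 2 * modulus c (S.u x)) :=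
        div_nonneg (mul_nonneg (mul_nonneg hlam hξ) (sub_nonneg.2 h3)) (by positivity)
      linarith
    -- Since λ_M ≥ 0, the pressure part may be added so that the full weighted wave energy appears
    -- on the right.
    have h6 : 0 ≤ S.lamM R / (k ^ 2 * c.im ^ 2)
        * (modulus c (S.u x) * normSq (w.P S k c x)) :=
      mul_nonneg (by positivity) (mul_nonneg hV.le (normSq_nonneg _))
    have h7 : S.Jm R * (normSq (w.h S k c x) / modulus c (S.u x))
        ≤ w.buoyancy S k c x / modulus c (S.u x) + S.lamM R / (k ^ 2 * c.im ^ 2)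
          * (modulus c (S.u x) * (k ^ 2 * w.ξsq S k c x)
            + modulus c (S.u x) * normSq (w.P S k c x)) := by
      rw [add_div, mul_div_assoc] at h1
      linarith
    have h8 := mul_le_mul_of_nonneg_left h7 (hS.ρ_pos' hx).le
    have h9 : 1 - S.μ R k c = S.lamM R / (k ^ 2 * c.im ^ 2) := by rw [BaseState.μ]; ring
    rw [h9]
    linarith
  · intro t ht
    obtain ⟨hi, h0⟩ := hw.phase_balance hS hk hc
    have iL := (iE.fun_add iP).fun_add iH
    have iR := (((iP.const_mul t).fun_add (ih.div_const t)).div_const 2).fun_add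
      (ih.const_mul (S.aMsq R / c.im ^ 2 / 4))
    rw [← sub_nonpos, ← integral_add iE iP, ← integral_add (iE.fun_add iP) iH, ← integral_const_mul,
      ← integral_div, ← integral_add (iP.const_mul t) (ih.div_const t), ← integral_div,
      ← integral_const_mul, ← integral_add (((iP.const_mul t).fun_add (ih.div_const t)).div_const 2)
      (ih.const_mul _), ← integral_sub iL iR, ← h0]
    refine integral_mono_ae (iL.sub iR) hi ?_
    filter_upwards [R.ae_mem_D] with x hx
    have hV := modulus_pos hc (S.u x)
    have h1 := cross_terms_ge (P := w.P S k c x) (δ := w.δ S k c x) (h := w.h S k c x) hV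
      (normSq_shifted S c x) hc (by rw [modulus_sq]; nlinarith [sq_nonneg (S.u x - c.re)])
      (sq_nonneg (S.a x)) (hS.a_sq_le hx) ht
    -- Only the buoyancy and a²|δ|² are kept from the potential energy; the latter is consumed by
    -- the cross terms.
    have h2 : w.buoyancy S k c x / modulus c (S.u x)
        + S.a x ^ 2 * normSq (w.δ S k c x) / modulus c (S.u x)
        ≤ w.potential S k c x / modulus c (S.u x) := by
      rw [← add_div]
      refine div_le_div_of_nonneg_right ?_ hV.le
      have h3 : 0 ≤ k ^ 2 * S.a x ^ 2 * w.ξsq S k c x :=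
        mul_nonneg (by positivity) (w.ξsq_nonneg k c S x)
      have h4 : 0 ≤ normSq (shifted S c x) ^ 2 / S.s x ^ 2 * normSq (w.P S k c x) :=
        mul_nonneg (by positivity) (normSq_nonneg _)
      rw [Perturbation.potential]
      linarith
    have h5 : modulus c (S.u x) * (k ^ 2 * w.ξsq S k c x)
        + modulus c (S.u x) * normSq (w.P S k c x) = modulus c (S.u x) * w.kinetic S k c x := by
      rw [Perturbation.kinetic]; ring
    have h6 := mul_le_mul_of_nonneg_left (add_le_add h1 h2) (hS.ρ_pos' hx).le
    have h7 : S.ρ x * (normSq (w.h S k c x) / modulus c (S.u x)) / t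
        = S.ρ x * (normSq (w.h S k c x) / modulus c (S.u x) / t) := by ring
    rw [← h5, h7]
    linarith

/-! ### Removal of the weights and the two final bounds. -/

/-- |U| is bounded, so the positive weighted displacement energy is at most a constant times this
integral. -/
lemma kinetic_pos : 0 < ∫ x, S.ρ x * w.kinetic S k c x ∂(R.cellMeasure) := by
  have hA := hS.ρ_reg.bddCont.mul_integrable (hw.integrable_kinetic hS hc)
  obtain ⟨C, hC⟩ := (hS.u_reg.bddCont.comp (continuous_modulus c)).2
  have iE := (integrable_weighted hS hc (hw.integrable_ξsq.const_mul (k ^ 2))).1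
  have h1 : ∫ x, S.ρ x * (modulus c (S.u x) * (k ^ 2 * w.ξsq S k c x)) ∂(R.cellMeasure)
      ≤ C * ∫ x, S.ρ x * w.kinetic S k c x ∂(R.cellMeasure) := by
    rw [← integral_const_mul]
    refine integral_mono_ae iE (hA.const_mul C) ?_
    filter_upwards [R.ae_mem_D] with x hx
    have hV := (le_abs_self _).trans (hC x hx)
    have h2 : k ^ 2 * w.ξsq S k c x ≤ w.kinetic S k c x :=
      le_add_of_nonneg_right (normSq_nonneg _)
    have h3 := mul_le_mul hV h2 (mul_nonneg (sq_nonneg k) (w.ξsq_nonneg k c S x))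
      ((modulus_pos hc _).le.trans hV)
    have h4 := mul_le_mul_of_nonneg_left h3 (hS.ρ_pos' hx).le
    linarith
  have h5 := (hw.displacement_energy_pos hS hk hc).trans_le h1
  have h6 : 0 ≤ ∫ x, S.ρ x * w.kinetic S k c x ∂(R.cellMeasure) := by
    refine integral_nonneg_of_ae ?_
    filter_upwards [R.ae_mem_D] with x hx
    exact mul_nonneg (hS.ρ_pos' hx).le (w.kinetic_nonneg S k c x)
  refine h6.lt_of_ne fun h => ?_
  rw [← h, mul_zero] at h5
  exact h5.false

omit hk in
/-- Removal of the weights from a bound of the buoyancy energy by the wave energy. -/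
lemma unweighted_buoyancy_ge (hN : ∀ x ∈ R.D, 0 ≤ S.N1sq x + S.N2sq x) {e : ℝ} (he : 0 ≤ e)
    (h : e * ∫ x, S.ρ x * (modulus c (S.u x) * w.kinetic S k c x) ∂(R.cellMeasure)
      ≤ ∫ x, S.ρ x * (w.buoyancy S k c x / modulus c (S.u x)) ∂(R.cellMeasure)) :
    e * c.im ^ 2 * ∫ x, S.ρ x * w.kinetic S k c x ∂(R.cellMeasure)
      ≤ ∫ x, S.ρ x * w.buoyancy S k c x ∂(R.cellMeasure) := by
  have iA := hS.ρ_reg.bddCont.mul_integrable (hw.integrable_kinetic hS hc)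
  have iH := hS.ρ_reg.bddCont.mul_integrable (hw.integrable_buoyancy hS)
  have iVA := (integrable_weighted hS hc (hw.integrable_kinetic hS hc)).1
  have iHV := (integrable_weighted hS hc (hw.integrable_buoyancy hS)).2
  -- The bound |U| ≥ |c_i| is spent twice, once on the weight |U| of the wave energy and once on the
  -- weight 1/|U| of the buoyancy.
  have h1 : |c.im| * ∫ x, S.ρ x * w.kinetic S k c x ∂(R.cellMeasure)
      ≤ ∫ x, S.ρ x * (modulus c (S.u x) * w.kinetic S k c x) ∂(R.cellMeasure) := by
    rw [← integral_const_mul]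
    refine integral_mono_ae (iA.const_mul _) iVA ?_
    filter_upwards [R.ae_mem_D] with x hx
    have := mul_le_mul_of_nonneg_right (abs_im_le_modulus c (S.u x))
      (mul_nonneg (hS.ρ_pos' hx).le (w.kinetic_nonneg S k c x))
    linarith
  have h2 : |c.im| * ∫ x, S.ρ x * (w.buoyancy S k c x / modulus c (S.u x)) ∂(R.cellMeasure)
      ≤ ∫ x, S.ρ x * w.buoyancy S k c x ∂(R.cellMeasure) := by
    rw [← integral_const_mul]
    refine integral_mono_ae (iHV.const_mul _) iH ?_
    filter_upwards [R.ae_mem_D] with x hx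
    have hV := modulus_pos hc (S.u x)
    have h3 := mul_le_mul_of_nonneg_right (abs_im_le_modulus c (S.u x))
      (mul_nonneg (hS.ρ_pos' hx).le (div_nonneg (buoyancy_nonneg w k c hS hN hx) hV.le))
    have h4 : modulus c (S.u x) * (S.ρ x * (w.buoyancy S k c x / modulus c (S.u x)))
        = S.ρ x * w.buoyancy S k c x := by field_simp
    rwa [h4] at h3
  have h3 := mul_le_mul_of_nonneg_left h1 he
  have h4 := mul_le_mul_of_nonneg_left (h3.trans h) (abs_nonneg c.im)
  rw [← sq_abs]
  linarith

/-- The excess Γ - 1 is what the buoyancy energy contributes to the semicircle inequality; where Γ =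
1, nonnegative buoyancy suffices. -/
lemma gam_bound (hN : ∀ x ∈ R.D, 0 ≤ S.N1sq x + S.N2sq x) :
    (c.re - S.uPlus R) ^ 2 + S.Gam R k c * c.im ^ 2 ≤ S.uMinus R ^ 2 - S.Θ R c := by
  have hs := hw.semicircle hS hk hc
  have hA := hw.kinetic_pos hS hk hc
  have key : (S.Gam R k c - 1) * c.im ^ 2 * ∫ x, S.ρ x * w.kinetic S k c x ∂(R.cellMeasure)
      ≤ ∫ x, S.ρ x * w.buoyancy S k c x ∂(R.cellMeasure) := by
    have h0 : 0 ≤ ∫ x, S.ρ x * w.buoyancy S k c x ∂(R.cellMeasure) := by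
      refine integral_nonneg_of_ae ?_
      filter_upwards [R.ae_mem_D] with x hx
      exact mul_nonneg (hS.ρ_pos' hx).le (buoyancy_nonneg w k c hS hN hx)
    rw [BaseState.Gam]
    split_ifs with hμ
    · rcases max_cases 1 (S.μ R k c + 4 * S.μ R k c ^ 2 * S.Jm R
        * ((1 + Real.sqrt (S.radicand R k c)) ^ 2)⁻¹) with ⟨h, -⟩ | ⟨h, h'⟩
      · rw [h]; simpa using h0
      · rw [h]
        exact hw.unweighted_buoyancy_ge hS hc hN (by linarith)
          (hw.buoyancy_energy_ge hS hk hc hN hμ).2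
    · simpa using h0
  have h1 : ((c.re - S.uPlus R) ^ 2 + S.Gam R k c * c.im ^ 2 - S.uMinus R ^ 2 + S.Θ R c)
      * ∫ x, S.ρ x * w.kinetic S k c x ∂(R.cellMeasure) ≤ 0 := by linarith
  have h2 := nonpos_of_mul_nonpos_left h1 hA
  linarith

lemma im_sq_lt (hN : ∀ x ∈ R.D, 0 ≤ S.N1sq x + S.N2sq x) (hJ : 1 / 4 < S.Jm R) :
    c.im ^ 2 < S.ciSqBound R k := by
  have hci : 0 < c.im ^ 2 := by positivity
  have hk2 : 0 < k ^ 2 := by positivity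
  have hJ' : 0 < 4 * S.Jm R - 1 := by linarith
  have hμ : S.μ R k c = 1 - S.lamM R / k ^ 2 / c.im ^ 2 := by rw [BaseState.μ, div_div]
  have root := fun X => lt_larger_root (A := 4 * S.Jm R - 1)
    (b := 4 * S.Jm R * (S.lamM R / k ^ 2) + S.aMsq R) (d := S.lamM R / k ^ 2 * S.aMsq R) (X := X)
    hJ'
  have hb : S.ciSqBound R k = (4 * S.Jm R * (S.lamM R / k ^ 2) + S.aMsq R
      + Real.sqrt ((4 * S.Jm R * (S.lamM R / k ^ 2) + S.aMsq R) ^ 2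
        - 4 * (4 * S.Jm R - 1) * (S.lamM R / k ^ 2 * S.aMsq R))) / (2 * (4 * S.Jm R - 1)) := by
    rw [BaseState.ciSqBound]
    congr 4
    ring
  rw [hb]
  set L := S.lamM R / k ^ 2 with hL
  rcases lt_or_ge 0 (S.μ R k c) with h | h
  -- The radicand times c_i⁴ is minus the quadratic of `root` at c_i².
  · have h1 := (hw.buoyancy_energy_ge hS hk hc hN h).1
    rw [BaseState.radicand, hμ] at h1
    apply root
    have h2 := mul_pos h1 (pow_pos hci 2)
    have h3 : (1 + (1 - L / c.im ^ 2) * (S.aMsq R / c.im ^ 2 - 4 * S.Jm R)) * (c.im ^ 2) ^ 2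
        = (c.im ^ 2) ^ 2 + (c.im ^ 2 - L) * (S.aMsq R - 4 * S.Jm R * c.im ^ 2) := by
      field_simp
    rw [h3] at h2
    linarith
  -- Here c_i² ≤ L, and the quadratic takes the value -L² < 0 at L, so L itself lies below the
  -- larger root.
  · rw [hμ, sub_nonpos, one_le_div hci] at h
    refine h.trans_lt (root L ?_)
    nlinarith

end IsNormalMode

end MagnetoShear

end

theorem theorem2 (R : MagnetoShear.CrossSection) (S : MagnetoShear.BaseState)
    (hS : S.IsAdmissible R)
    (hN : ∀ x ∈ R.D, 0 ≤ S.N1sq x + S.N2sq x)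
    (k : ℝ) (hk : 0 < k) (c : ℂ) (hc : c.im ≠ 0)
    (w : MagnetoShear.Perturbation) (hw : MagnetoShear.IsNormalMode R S k c w) :
    (0 < S.μ R k c → 0 < S.radicand R k c) ∧
    (c.re - S.uPlus R) ^ 2 + S.Gam R k c * c.im ^ 2 ≤ S.uMinus R ^ 2 - S.Θ R c ∧
    (1 / 4 < S.Jm R → c.im ^ 2 < S.ciSqBound R k) := by
  have hk' := hk.ne'
  exact ⟨fun hμ => (hw.buoyancy_energy_ge hS hk' hc hN hμ).1, hw.gam_bound hS hk' hc hN,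
    hw.im_sq_lt hS hk' hc hN⟩
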